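/- Let $n\ge 1$, and let $du$ denote integration with respect to the $(n-1)$-dimensional Hausdorff measure on the unit sphere $S^{n-1}\subset\mathbb{R}^n$. Let $\mathcal{K}_o^n$ be the set of compact convex sets $K\subset\mathbb{R}^n$ containing the origin $o$ in their interior. For $K\in\mathcal{K}_o^n$ and $u\in S^{n-1}$ put $h_K(u)=\sup_{x\in K}\langle u,x\rangle$, $\rho_K(u)=\sup\{\lambda>0:\lambda u\in K\}$ and $H(K,u)=\{x\in\mathbb{R}^n:\langle x,u\rangle=h_K(u)\}$. Let $\alpha_K(u)$ be the unit vector $v$ with $\rho_K(u)u\in H(K,v)$, which is unique for almost every $u\in S^{n-1}$, and for $E\subset S^{n-1}$ let $\boldsymbol{\alpha}^*_K(E)=\{x/|x| : x\in\partial K\cap H(K,v)\text{ for some }v\in E\}$. Let $\phi:\mathbb{R}^n\setminus\{o\}\to(0,\infty)$ be continuous and such that $$\overline{\Phi}(t,u)=\int_t^\infty\phi(ru)\,r^{n-1}\,dr$$ is finite and continuous on $(0,\infty)\times S^{n-1}$. For $v\in S^{n-1}$, $b>0$ and $0<c<1$ let $C(v,b,c)=\{x\in\mathbb{R}^n:|x|\ge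 b\text{ and }\langle x/|x|,v\rangle\ge c\}$, and suppose that for all $v\in S^{n-1}$ and $0<c<1$ $$\lim_{b\to0+}\int_{C(v,b,c)}\phi(x)\,dx=\infty .$$ Let $\psi:(0,\infty)\to(0,\infty)$ be continuous with $\int_1^\infty\frac{\psi(s)}{s}\,ds=\infty$. For $K\in\mathcal{K}_o^n$ and Borel sets $E\subset S^{n-1}$ let $$\widetilde{C}_{\phi,\psi}(K,E)=\frac1n\int_{\boldsymbol{\alpha}^*_K(E)}\frac{\phi(\rho_K(u)u)\,\rho_K(u)^n}{\psi(h_K(\alpha_K(u)))}\,du .$$ Let $\mu$ be a nonzero finite Borel measure on $S^{n-1}$ that is not concentrated on any closed hemisphere, i.e. $\int_{S^{n-1}}\max\{\langle u,v\rangle,0\}\,d\mu(u)>0$ for all $v\in S^{n-1}$, and write $|\mu|=\mu(S^{n-1})$. Then there exists $K\in\mathcal{K}_o^n$ such that $\widetilde{C}_{\phi,\psi}(K,S^{n-1})\ne0$ and $$\frac{\mu(E)}{|\mu|}=\frac{\widetilde{C}_{\phi,\psi}(K,E)}{\widetilde{C}_{\phi,\psi}(K,S^{n-1})}\qquad\text{for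 every Borel set }E\subset S^{n-1}.$$ -/

import Mathlib

open MeasureTheory Set Filter Topology
open scoped ENNReal

noncomputable section

namespace DualOrlicz

/-- Euclidean space `ℝⁿ`. -/
abbrev RSpace (n : ℕ) : Type := EuclideanSpace ℝ (Fin n)

/-- The unit sphere `Sⁿ⁻¹` of `ℝⁿ`. -/
abbrev USphere (n : ℕ) : Type := Metric.sphere (0 : RSpace n) 1

/-- Spherical Lebesgue measure `du` on `Sⁿ⁻¹`, i.e. the `(n-1)`-dimensional Hausdorff measure
with its Euclidean normalization (total mass `n` times the volume of the unit ball). -/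
def sphereMeasure (n : ℕ) : Measure (USphere n) := (volume : Measure (RSpace n)).toSphere

variable {n : ℕ}

/-- The support function `h_K(u) = sup_{x ∈ K} ⟨u, x⟩`. -/
def supportFn (K : Set (RSpace n)) (u : USphere n) : ℝ :=
  sSup ((fun x : RSpace n => inner ℝ (u : RSpace n) x) '' K)

/-- The radial function `ρ_K(u) = sup {s > 0 : s u ∈ K}`. -/
def radialFn (K : Set (RSpace n)) (u : USphere n) : ℝ :=
  sSup {s : ℝ | 0 < s ∧ s • (u : RSpace n) ∈ K}

/-- The supporting hyperplane `H(K, u) = {x : ⟨x, u⟩ = h_K(u)}`. -/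
def supportingHyperplane (K : Set (RSpace n)) (u : USphere n) : Set (RSpace n) :=
  {x | inner ℝ x (u : RSpace n) = supportFn K u}

/-- The set-valued radial Gauss image: all outer unit normals of `K` at the boundary points
`ρ_K(u) u` with `u ∈ A`. -/
def radialGaussImage (K : Set (RSpace n)) (A : Set (USphere n)) : Set (USphere n) :=
  {v | ∃ u ∈ A, radialFn K u • (u : RSpace n) ∈ supportingHyperplane K v}

/-- The reverse radial Gauss image: the directions `x / |x|` of all boundary points `x` of `K`
that have an outer unit normal in `A`. -/
def reverseRadialGaussImage (K : Set (RSpace n)) (A : Set (USphere n)) : Set (USphere n) :=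
  {u | ∃ v ∈ A, ∃ x ∈ frontier K ∩ supportingHyperplane K v,
    (u : RSpace n) = ‖x‖⁻¹ • x}

open Classical in
/-- The radial Gauss map `α_K`: the unique element of the radial Gauss image of `{u}`. The
directions `u` where that image has two or more elements form a null set for a convex body with
the origin in its interior; there the value is immaterial and set to `u`. -/
def radialGaussMap (K : Set (RSpace n)) (u : USphere n) : USphere n :=
  if h : ∃! v, v ∈ radialGaussImage K {u} then h.choose else u

/-- `Φ̄(t, u) = ∫_t^∞ φ(r u) r^{n-1} dr`, with values in `[0, ∞]`. -/
def PhiBar (φ : RSpace n → ℝ) (p : ℝ × USphere n) : ℝ≥0∞ :=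
  ∫⁻ r in Ioi p.1, ENNReal.ofReal (φ (r • (p.2 : RSpace n)) * r ^ (n - 1))

/-- The truncated cone `C(v, b, c) = {x : |x| ≥ b and ⟨x / |x|, v⟩ ≥ c}`. -/
def truncatedCone (v : USphere n) (b c : ℝ) : Set (RSpace n) :=
  {x | b ≤ ‖x‖ ∧ c ≤ inner ℝ (‖x‖⁻¹ • x) (v : RSpace n)}

/-- The `φ`-volume `∫_A φ(x) dx`, with values in `[0, ∞]`. For `A = C(v, b, c)` with `b > 0` it is
`∫_{⟨u, v⟩ ≥ c} Φ̄(b, u) du`. -/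
def phiVolume (φ : RSpace n → ℝ) (A : Set (RSpace n)) : ℝ≥0∞ :=
  ∫⁻ x in A, ENNReal.ofReal (φ x)

/-- The general dual Orlicz curvature measure
`C̃_{φ,ψ}(K, A) = (1/n) ∫_{α*_K(A)} φ(ρ_K(u) u) ρ_K(u)ⁿ / ψ(h_K(α_K(u))) du`. -/
def dualOrliczCurvature (φ : RSpace n → ℝ) (ψ : ℝ → ℝ) (K : Set (RSpace n))
    (A : Set (USphere n)) : ℝ :=
  (1 / (n : ℝ)) * ∫ u in reverseRadialGaussImage K A,
    φ (radialFn K u • (u : RSpace n)) * radialFn K u ^ n / ψ (supportFn K (radialGaussMap K u))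
    ∂(sphereMeasure n)

/-- `μ` is not concentrated on any closed hemisphere: `∫ ⟨u, v⟩₊ dμ(u) > 0` for all `v`. -/
def NotConcentratedOnHemisphere (μ : Measure (USphere n)) : Prop :=
  ∀ v : USphere n, 0 < ∫ u, max (inner ℝ (u : RSpace n) (v : RSpace n)) 0 ∂μ

end DualOrlicz

end

/-!
Positive continuous functions `f` on the sphere parametrize convex bodies through their Wulff
shapes. Let `Ψ` be a primitive of `ψ(s) / s`, and minimize the energy `∫ Ψ(f) dμ` among those `f`
for which the `φ`-volume of the complement of the Wulff shape is at most that of the complement of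
the unit ball.

The competitors are bounded below, since a Wulff shape with a small `f v` misses a cone of large
`φ`-volume. They are bounded above along a minimizing sequence: a support function which is large at
one point is large on a cap whose `μ`-mass is bounded below, because `μ` is not concentrated on a
hemisphere, and `Ψ` is unbounded. Replacing `f` by its polar bidual, the support function of its
Wulff shape, keeps the constraint, does not increase the energy and bounds the Lipschitz constant by
the maximum. Hence a minimizer exists by the Arzelà–Ascoli theorem and may be taken to be a support
function.

Under the perturbation `f e^{tg}` the logarithm of the radial function of the Wulff shape has
derivative `g(α(u))` at every direction `u` with a unique normal `α(u)`, hence for almost every `u`.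
Thus the `φ`-volume of the complement has derivative `-∫ g dC`, where `C` is the dual curvature
measure of the Wulff shape, while the energy has derivative `∫ ψ(f) g dμ`. Minimality makes the
latter nonnegative whenever `∫ g dC > 0`, which forces `ψ(f) μ = c C`.
-/


noncomputable section

namespace DualOrlicz

open Metric
open scoped InnerProductSpace

section PosContinuous

variable {X : Type*} [TopologicalSpace X] {f : X → ℝ}

/-- Positive continuous functions: the candidates for support functions of convex bodies with the
origin in the interior. -/
structure PosContinuous (f : X → ℝ) : Prop where
  continuous : Continuous f
  pos : ∀ x, 0 < f x

namespace PosContinuous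

theorem inv (hf : PosContinuous f) : PosContinuous fun x => (f x)⁻¹ :=
  ⟨hf.continuous.inv₀ fun x => (hf.pos x).ne', fun x => inv_pos.2 (hf.pos x)⟩

theorem exists_le [CompactSpace X] [Nonempty X] (hf : PosContinuous f) : ∃ R > 0, ∀ x, f x ≤ R :=
  let ⟨x, _, hx⟩ := isCompact_univ.exists_isMaxOn univ_nonempty hf.continuous.continuousOn
  ⟨f x, hf.pos x, fun y => hx (mem_univ y)⟩

theorem exists_pos_le [CompactSpace X] [Nonempty X] (hf : PosContinuous f) :
    ∃ r > 0, ∀ x, r ≤ f x := by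
  obtain ⟨R, hR, hfR⟩ := hf.inv.exists_le
  exact ⟨R⁻¹, inv_pos.2 hR, fun x => inv_le_of_inv_le₀ (hf.pos x) (hfR x)⟩

end PosContinuous

end PosContinuous

section Sphere

variable {E : Type*} [NormedAddCommGroup E] [InnerProductSpace ℝ E]

theorem inner_sphere_le (x : E) (v : sphere (0 : E) 1) : ⟪x, v⟫_ℝ ≤ ‖x‖ := by
  simpa only [norm_eq_of_mem_sphere, mul_one] using real_inner_le_norm x (v : E)

theorem inner_sphere_self (v : sphere (0 : E) 1) : ⟪(v : E), v⟫_ℝ = 1 :=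
  inner_self_eq_one_of_norm_eq_one (norm_eq_of_mem_sphere v)

instance nonempty_unitSphere [Nontrivial E] : Nonempty (sphere (0 : E) 1) :=
  (NormedSpace.sphere_nonempty.2 zero_le_one).to_subtype

theorem exists_eq_norm_smul_sphere [Nontrivial E] (x : E) :
    ∃ u : sphere (0 : E) 1, x = ‖x‖ • (u : E) := by
  rcases eq_or_ne x 0 with rfl | hx
  · exact ⟨Classical.arbitrary _, by simp only [norm_zero, zero_smul]⟩
  · exact ⟨⟨‖x‖⁻¹ • x, by simp [norm_smul, hx]⟩, (smul_inv_smul₀ (norm_ne_zero_iff.2 hx) x).symm⟩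

end Sphere

/-! ### Wulff shapes and polar duality -/

section Wulff

variable {E : Type*} [NormedAddCommGroup E] [InnerProductSpace ℝ E]

/-- The Wulff shape of `f`: the intersection of the half-spaces at distance `f v` from the origin
with outer normal `v`. -/
def wulffShape (f : sphere (0 : E) 1 → ℝ) : Set E := {x | ∀ v : sphere (0 : E) 1, ⟪x, v⟫_ℝ ≤ f v}

/-- The gauge (Minkowski functional) of the Wulff shape of `f`. -/
def wulffGauge (f : sphere (0 : E) 1 → ℝ) (x : E) : ℝ := ⨆ v : sphere (0 : E) 1, ⟪x, v⟫_ℝ / f v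

/-- The reciprocal of the radial function of the Wulff shape of `f`. If `f` is the support function
of a convex body, this is the support function of the polar body. -/
def polarDual (f : sphere (0 : E) 1 → ℝ) (u : sphere (0 : E) 1) : ℝ := wulffGauge f u

theorem wulffGauge_smul (f : sphere (0 : E) 1 → ℝ) {s : ℝ} (hs : 0 ≤ s) (x : E) :
    wulffGauge f (s • x) = s * wulffGauge f x := by
  simp only [wulffGauge, real_inner_smul_left, mul_div_assoc]
  exact (Real.mul_iSup_of_nonneg hs _).symm

theorem isClosed_wulffShape (f : sphere (0 : E) 1 → ℝ) : IsClosed (wulffShape f) := by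
  simp only [wulffShape, ofPred_forall]
  exact isClosed_iInter fun v => isClosed_le (by fun_prop) continuous_const

theorem wulffShape_subset_closedBall [Nontrivial E] {f : sphere (0 : E) 1 → ℝ} {R : ℝ}
    (hf : ∀ v, f v ≤ R) : wulffShape f ⊆ closedBall 0 R := by
  intro x hx
  obtain ⟨v, hv⟩ := exists_eq_norm_smul_sphere x
  rw [mem_closedBall_zero_iff]
  calc ‖x‖ = ⟪‖x‖ • (v : E), v⟫_ℝ := by rw [real_inner_smul_left, inner_sphere_self, mul_one]
    _ ≤ R := hv ▸ (hx v).trans (hf v)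

theorem closedBall_subset_wulffShape {f : sphere (0 : E) 1 → ℝ} {r : ℝ} (hf : ∀ v, r ≤ f v) :
    closedBall 0 r ⊆ wulffShape f :=
  fun x hx v => (inner_sphere_le x v).trans ((mem_closedBall_zero_iff.1 hx).trans (hf v))

variable [FiniteDimensional ℝ E] {f g : sphere (0 : E) 1 → ℝ}

namespace PosContinuous

theorem inner_le_wulffGauge_mul (hf : PosContinuous f) (x : E) (v : sphere (0 : E) 1) :
    ⟪x, v⟫_ℝ ≤ wulffGauge f x * f v := by
  have hcont : Continuous fun v : sphere (0 : E) 1 => ⟪x, v⟫_ℝ / f v :=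
    (by fun_prop : Continuous fun v : sphere (0 : E) 1 => ⟪x, v⟫_ℝ).div hf.continuous
      fun v => (hf.pos v).ne'
  exact (div_le_iff₀ (hf.pos v)).1 (le_ciSup (isCompact_range hcont).bddAbove v)

theorem inv_le_polarDual (hf : PosContinuous f) (u : sphere (0 : E) 1) :
    (f u)⁻¹ ≤ polarDual f u := by
  rw [inv_le_iff_one_le_mul₀ (hf.pos u), ← inner_sphere_self u]
  exact hf.inner_le_wulffGauge_mul u u

variable [Nontrivial E]

theorem wulffGauge_le_iff (hf : PosContinuous f) {x : E} {c : ℝ} :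
    wulffGauge f x ≤ c ↔ ∀ v : sphere (0 : E) 1, ⟪x, v⟫_ℝ ≤ c * f v :=
  ⟨fun h v => (hf.inner_le_wulffGauge_mul x v).trans
    (mul_le_mul_of_nonneg_right h (hf.pos v).le),
   fun h => ciSup_le fun v => (div_le_iff₀ (hf.pos v)).2 (h v)⟩

theorem exists_inner_eq_wulffGauge_mul (hf : PosContinuous f) (x : E) :
    ∃ v : sphere (0 : E) 1, ⟪x, v⟫_ℝ = wulffGauge f x * f v := by
  obtain ⟨v, -, hv⟩ := isCompact_univ.exists_isMaxOn univ_nonempty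
    (f := fun v : sphere (0 : E) 1 => ⟪x, v⟫_ℝ / f v)
    ((by fun_prop : Continuous fun v : sphere (0 : E) 1 => ⟪x, v⟫_ℝ).div hf.continuous
      fun v => (hf.pos v).ne').continuousOn
  exact ⟨v, (hf.inner_le_wulffGauge_mul x v).antisymm <|
    (le_div_iff₀ (hf.pos v)).1 (ciSup_le fun w => hv (mem_univ w))⟩

theorem mem_wulffShape_iff (hf : PosContinuous f) {x : E} :
    x ∈ wulffShape f ↔ wulffGauge f x ≤ 1 := by
  simp only [hf.wulffGauge_le_iff, one_mul, wulffShape, mem_ofPred_eq]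

theorem wulffGauge_add_le (hf : PosContinuous f) (x y : E) :
    wulffGauge f (x + y) ≤ wulffGauge f x + wulffGauge f y := by
  refine hf.wulffGauge_le_iff.2 fun v => ?_
  rw [inner_add_left, add_mul]
  exact add_le_add (hf.inner_le_wulffGauge_mul x v) (hf.inner_le_wulffGauge_mul y v)

theorem wulffGauge_le_inv_mul_norm (hf : PosContinuous f) {r : ℝ} (hr : 0 < r)
    (hrf : ∀ v, r ≤ f v) (x : E) : wulffGauge f x ≤ r⁻¹ * ‖x‖ := by
  refine hf.wulffGauge_le_iff.2 fun v => (inner_sphere_le x v).trans ?_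
  rw [mul_right_comm, inv_mul_eq_div]
  exact le_mul_of_one_le_left (norm_nonneg x) ((one_le_div hr).2 (hrf v))

theorem lipschitzWith_wulffGauge (hf : PosContinuous f) {r : ℝ} (hr : 0 < r)
    (hrf : ∀ v, r ≤ f v) : LipschitzWith (r⁻¹).toNNReal (wulffGauge f) := by
  refine LipschitzWith.of_le_add_mul _ fun x y => ?_
  rw [Real.coe_toNNReal _ (inv_nonneg.2 hr.le), dist_eq_norm]
  calc wulffGauge f x = wulffGauge f (y + (x - y)) := by rw [add_sub_cancel]
    _ ≤ wulffGauge f y + wulffGauge f (x - y) := hf.wulffGauge_add_le _ _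
    _ ≤ wulffGauge f y + r⁻¹ * ‖x - y‖ := by
      gcongr; exact hf.wulffGauge_le_inv_mul_norm hr hrf _

theorem lipschitzWith_polarDual (hf : PosContinuous f) {r : ℝ} (hr : 0 < r)
    (hrf : ∀ v, r ≤ f v) : LipschitzWith (r⁻¹).toNNReal (polarDual f) := by
  rw [← mul_one (r⁻¹).toNNReal]
  exact (hf.lipschitzWith_wulffGauge hr hrf).comp (LipschitzWith.subtype_val _)

protected theorem polarDual (hf : PosContinuous f) : PosContinuous (polarDual f) :=
  let ⟨_, hr, hrf⟩ := hf.exists_pos_le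
  ⟨(hf.lipschitzWith_polarDual hr hrf).continuous,
    fun u => (inv_pos.2 (hf.pos u)).trans_le (hf.inv_le_polarDual u)⟩

theorem polarDual_anti (hf : PosContinuous f) (hg : PosContinuous g) (h : ∀ v, f v ≤ g v)
    (u : sphere (0 : E) 1) : polarDual g u ≤ polarDual f u :=
  hg.wulffGauge_le_iff.2 fun v => (hf.inner_le_wulffGauge_mul _ v).trans
    (mul_le_mul_of_nonneg_left (h v) (hf.polarDual.pos u).le)

theorem polarDual_polarDual_le (hf : PosContinuous f) (v : sphere (0 : E) 1) :
    polarDual (polarDual f) v ≤ f v := by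
  refine hf.polarDual.wulffGauge_le_iff.2 fun u => ?_
  rw [real_inner_comm, mul_comm]
  exact hf.inner_le_wulffGauge_mul _ v

theorem polarDual_polarDual_polarDual (hf : PosContinuous f) :
    polarDual (polarDual (polarDual f)) = polarDual f :=
  funext fun u => le_antisymm (hf.polarDual.polarDual_polarDual_le u)
    (hf.polarDual.polarDual.polarDual_anti hf hf.polarDual_polarDual_le u)

theorem lipschitzWith_polarDual_polarDual (hf : PosContinuous f) {R : ℝ} (hR : 0 < R)
    (hfR : ∀ v, polarDual (polarDual f) v ≤ R) :
    LipschitzWith R.toNNReal (polarDual (polarDual f)) := by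
  have hle (v) : R⁻¹ ≤ polarDual f v := by
    rw [← hf.polarDual_polarDual_polarDual]
    exact (inv_anti₀ (hf.polarDual.polarDual.pos v) (hfR v)).trans
      (hf.polarDual.polarDual.inv_le_polarDual v)
  simpa only [inv_inv] using hf.polarDual.lipschitzWith_polarDual (inv_pos.2 hR) hle

theorem exists_mul_inner_le (hf : PosContinuous f) (hff : polarDual (polarDual f) = f)
    (w : sphere (0 : E) 1) :
    ∃ u : sphere (0 : E) 1, ∀ v : sphere (0 : E) 1, f w * ⟪(v : E), u⟫_ℝ ≤ f v := by
  obtain ⟨u, hu⟩ := hf.polarDual.exists_inner_eq_wulffGauge_mul w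
  replace hu : ⟪(w : E), u⟫_ℝ = f w * polarDual f u := by rw [hu, ← congrFun hff w]; rfl
  have hwu : f w * polarDual f u ≤ 1 :=
    hu ▸ (inner_sphere_le (w : E) u).trans (norm_eq_of_mem_sphere w).le
  refine ⟨u, fun v => ?_⟩
  calc f w * ⟪(v : E), u⟫_ℝ ≤ f w * (polarDual f u * f v) := by
        rw [real_inner_comm]
        exact mul_le_mul_of_nonneg_left (hf.inner_le_wulffGauge_mul _ v) (hf.pos w).le
    _ ≤ f v := by rw [← mul_assoc]; exact mul_le_of_le_one_left (hf.pos v).le hwu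

theorem smul_mem_wulffShape_iff (hf : PosContinuous f) {s : ℝ} (hs : 0 ≤ s)
    (u : sphere (0 : E) 1) : s • (u : E) ∈ wulffShape f ↔ s ≤ (polarDual f u)⁻¹ := by
  rw [hf.mem_wulffShape_iff, wulffGauge_smul f hs, ← one_div, le_div_iff₀ (hf.polarDual.pos u),
    polarDual]

theorem wulffShape_polarDual_polarDual (hf : PosContinuous f) :
    wulffShape (polarDual (polarDual f)) = wulffShape f := by
  ext x
  obtain ⟨u, hu⟩ := exists_eq_norm_smul_sphere x
  rw [hu, hf.polarDual.polarDual.smul_mem_wulffShape_iff (norm_nonneg x),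
    hf.smul_mem_wulffShape_iff (norm_nonneg x), hf.polarDual_polarDual_polarDual]

end PosContinuous
end Wulff

/-! ### Normals and the radial Gauss map -/

section Normal

theorem aemeasurable_of_ae_continuousAt {X Y : Type*} [TopologicalSpace X] [MeasurableSpace X]
    [OpensMeasurableSpace X] [TopologicalSpace Y] [TopologicalSpace.PseudoMetrizableSpace Y]
    [MeasurableSpace Y] [BorelSpace Y] {ν : Measure X} {h : X → Y}
    (hh : ∀ᵐ x ∂ν, ContinuousAt h x) : AEMeasurable h ν := by
  rw [← Measure.restrict_eq_self_of_ae_mem hh]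
  exact ContinuousOn.aemeasurable (fun x hx => ContinuousAt.continuousWithinAt hx)
    (IsGδ.setOfPred_continuousAt h).measurableSet

theorem ae_toSphere_of_ae {E : Type*} [NormedAddCommGroup E] [NormedSpace ℝ E]
    [MeasurableSpace E] [BorelSpace E] (ν : Measure E) {p : E → Prop}
    (hp : MeasurableSet {x | p x}) (hsmul : ∀ s : ℝ, 0 < s → ∀ x, p (s • x) → p x)
    (h : ∀ᵐ x ∂ν, p x) : ∀ᵐ u : sphere (0 : E) 1 ∂ν.toSphere, p u := by
  have hmeas : MeasurableSet {u : sphere (0 : E) 1 | p u} := hp.preimage measurable_subtype_coe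
  rw [ae_iff, ← compl_ofPred, Measure.toSphere_apply' _ hmeas.compl]
  refine mul_eq_zero_of_right _ (measure_mono_null ?_ (ae_iff.1 h))
  rintro _ ⟨s, hs, _, ⟨u, hu, rfl⟩, rfl⟩ hsu
  exact hu (hsmul s hs.1 u hsu)

variable {E : Type*} [NormedAddCommGroup E] [InnerProductSpace ℝ E]
  {f : sphere (0 : E) 1 → ℝ} {u v : sphere (0 : E) 1}

/-- `v` is an outer unit normal of the Wulff shape of `f` at its boundary point in direction `u`,
and the half-space with normal `v` is active in the intersection defining the Wulff shape. -/
def IsNormal (f : sphere (0 : E) 1 → ℝ) (u v : sphere (0 : E) 1) : Prop :=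
  ⟪(u : E), v⟫_ℝ = polarDual f u * f v

/-- The radial Gauss map of the Wulff shape of `f`: a choice of normal in every direction. -/
def normalMap (f : sphere (0 : E) 1 → ℝ) (u : sphere (0 : E) 1) : sphere (0 : E) 1 :=
  haveI : Nonempty (sphere (0 : E) 1) := ⟨u⟩
  Classical.epsilon (IsNormal f u)

variable [FiniteDimensional ℝ E]

theorem PosContinuous.isNormal_normalMap [Nontrivial E] (hf : PosContinuous f)
    (u : sphere (0 : E) 1) : IsNormal f u (normalMap f u) :=
  Classical.epsilon_spec (hf.exists_inner_eq_wulffGauge_mul (u : E))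

theorem IsNormal.fderiv_wulffGauge (h : IsNormal f u v) (hf : PosContinuous f)
    (hd : DifferentiableAt ℝ (wulffGauge f) u) :
    fderiv ℝ (wulffGauge f) u = innerSL ℝ ((f v)⁻¹ • (v : E)) := by
  have eq_div (y : E) : innerSL ℝ ((f v)⁻¹ • (v : E)) y = ⟪y, v⟫_ℝ / f v := by
    rw [innerSL_apply_apply, real_inner_smul_left, real_inner_comm, inv_mul_eq_div]
  have hmin : IsLocalMin (wulffGauge f - ⇑(innerSL ℝ ((f v)⁻¹ • (v : E)))) (u : E) := by
    refine Eventually.of_forall fun y => ?_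
    simp only [Pi.sub_apply, eq_div]
    rw [(div_eq_iff (hf.pos v).ne').2 h, polarDual, sub_self, sub_nonneg, div_le_iff₀ (hf.pos v)]
    exact hf.inner_le_wulffGauge_mul y v
  have h0 := hmin.fderiv_eq_zero
  rwa [fderiv_sub hd (ContinuousLinearMap.differentiableAt _), ContinuousLinearMap.fderiv,
    sub_eq_zero] at h0

theorem IsNormal.eq_of_differentiableAt {w : sphere (0 : E) 1} (hv : IsNormal f u v)
    (hw : IsNormal f u w) (hf : PosContinuous f) (hd : DifferentiableAt ℝ (wulffGauge f) u) :
    v = w := by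
  have hvw : (f v)⁻¹ • (v : E) = (f w)⁻¹ • (w : E) := (InnerProductSpace.toDualMap ℝ E).injective
    ((hv.fderiv_wulffGauge hf hd).symm.trans (hw.fderiv_wulffGauge hf hd))
  refine Subtype.ext ((sameRay_iff_of_norm_eq (by simp only [norm_eq_of_mem_sphere])).1 ?_)
  exact (SameRay.sameRay_pos_smul_right _ (inv_pos.2 (hf.pos v))).trans
    (hvw ▸ SameRay.sameRay_pos_smul_left _ (inv_pos.2 (hf.pos w)))
    fun h0 => absurd h0 (smul_ne_zero (inv_pos.2 (hf.pos v)).ne' (ne_zero_of_mem_unit_sphere v))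

/-- Every cluster point of `w` is a normal in direction `u`; the sphere is compact. -/
theorem tendsto_of_isNormal {ι : Type*} {l : Filter ι} {F : ι → sphere (0 : E) 1 → ℝ}
    {U w : ι → sphere (0 : E) 1} (hf : Continuous f) (hF : TendstoUniformly F f l)
    (hU : Tendsto U l (𝓝 u))
    (hdual : Tendsto (fun i => polarDual (F i) (U i)) l (𝓝 (polarDual f u)))
    (hw : ∀ i, IsNormal (F i) (U i) (w i)) (huniq : ∃! v, IsNormal f u v)
    (hv : IsNormal f u v) : Tendsto w l (𝓝 v) := by
  refine isCompact_univ.tendsto_nhds_of_unique_mapClusterPt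
    (Eventually.of_forall fun i => mem_univ _) fun z _ hz => huniq.unique ?_ hv
  obtain ⟨l', hl', hwz⟩ := mapClusterPt_iff_ultrafilter.1 hz
  have hleft : Tendsto (fun i => ⟪(U i : E), w i⟫_ℝ) l' (𝓝 ⟪(u : E), z⟫_ℝ) :=
    ((continuous_subtype_val.tendsto u).comp (hU.mono_left hl')).inner
      ((continuous_subtype_val.tendsto z).comp hwz)
  have hF' : TendstoUniformly F f l' := fun s hs => hl' (hF s hs)
  have hFw : Tendsto (fun i => F i (w i)) l' (𝓝 (f z)) := hF'.tendsto_comp hf.continuousAt hwz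
  exact tendsto_nhds_unique hleft (((hdual.mono_left hl').mul hFw).congr fun i => (hw i).symm)

variable [Nontrivial E]

theorem PosContinuous.ae_differentiableAt_wulffGauge [MeasurableSpace E] [BorelSpace E]
    (ν : Measure E) [ν.IsAddHaarMeasure] (hf : PosContinuous f) :
    ∀ᵐ u : sphere (0 : E) 1 ∂ν.toSphere, DifferentiableAt ℝ (wulffGauge f) u := by
  obtain ⟨r, hr, hrf⟩ := hf.exists_pos_le
  refine ae_toSphere_of_ae ν (measurableSet_of_differentiableAt ℝ _) (fun s hs x hx => ?_)
    (hf.lipschitzWith_wulffGauge hr hrf).ae_differentiableAt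
  have heq : wulffGauge f = fun y => s⁻¹ * wulffGauge f (s • y) := by
    funext y
    rw [wulffGauge_smul f hs.le, inv_mul_cancel_left₀ hs.ne']
  rw [heq]
  exact (DifferentiableAt.comp x hx (differentiableAt_id.const_smul s)).const_mul _

theorem PosContinuous.ae_existsUnique_isNormal [MeasurableSpace E] [BorelSpace E]
    (ν : Measure E) [ν.IsAddHaarMeasure] (hf : PosContinuous f) :
    ∀ᵐ u ∂ν.toSphere, ∃! v, IsNormal f u v := by
  filter_upwards [hf.ae_differentiableAt_wulffGauge ν] with u hu
  exact ⟨normalMap f u, hf.isNormal_normalMap u, fun w hw =>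
    hw.eq_of_differentiableAt (hf.isNormal_normalMap u) hf hu⟩

theorem PosContinuous.continuousAt_normalMap (hf : PosContinuous f) (hu : ∃! v, IsNormal f u v) :
    ContinuousAt (normalMap f) u :=
  tendsto_of_isNormal hf.continuous
    (fun _ hs => Eventually.of_forall fun _ _ => refl_mem_uniformity hs) continuousAt_id
    hf.polarDual.continuous.continuousAt hf.isNormal_normalMap hu (hf.isNormal_normalMap u)

theorem PosContinuous.aemeasurable_normalMap [MeasurableSpace E] [BorelSpace E]
    (ν : Measure E) [ν.IsAddHaarMeasure] (hf : PosContinuous f) :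
    AEMeasurable (normalMap f) ν.toSphere :=
  aemeasurable_of_ae_continuousAt <|
    (hf.ae_existsUnique_isNormal ν).mono fun _ => hf.continuousAt_normalMap

end Normal

/-! ### Logarithmic perturbations -/

section Perturb

variable {X : Type*} {f g : X → ℝ}

/-- The logarithmic perturbation `f e^{t g}` of `f`. -/
def perturb (f g : X → ℝ) (t : ℝ) (x : X) : ℝ := f x * Real.exp (t * g x)

@[simp]
theorem perturb_zero (f g : X → ℝ) : perturb f g 0 = f := by
  funext x
  simp only [perturb, zero_mul, Real.exp_zero, mul_one]

theorem perturb_perturb (f g : X → ℝ) (s t : ℝ) :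
    perturb (perturb f g s) g t = perturb f g (s + t) := by
  funext x
  simp only [perturb, add_mul, Real.exp_add, mul_assoc]

theorem continuous_uncurry_perturb [TopologicalSpace X] (hf : Continuous f) (hg : Continuous g) :
    Continuous fun p : ℝ × X => perturb f g p.1 p.2 := by
  unfold perturb
  fun_prop

protected theorem PosContinuous.perturb [TopologicalSpace X] (hf : PosContinuous f)
    (hg : Continuous g) (t : ℝ) : PosContinuous (perturb f g t) :=
  ⟨(continuous_uncurry_perturb hf.continuous hg).comp (Continuous.prodMk_right t),
    fun x => mul_pos (hf.pos x) (Real.exp_pos _)⟩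

end Perturb

section LogRadius

variable {E : Type*} [NormedAddCommGroup E] [InnerProductSpace ℝ E]
  {f g : sphere (0 : E) 1 → ℝ} {u v : sphere (0 : E) 1}

/-- The logarithm of the radial function of the Wulff shape of `f`. -/
def logRadius (f : sphere (0 : E) 1 → ℝ) (u : sphere (0 : E) 1) : ℝ := -Real.log (polarDual f u)

variable [FiniteDimensional ℝ E] [Nontrivial E]

theorem PosContinuous.exp_neg_logRadius (hf : PosContinuous f) (u : sphere (0 : E) 1) :
    Real.exp (-logRadius f u) = polarDual f u := by
  rw [logRadius, neg_neg, Real.exp_log (hf.polarDual.pos u)]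

theorem PosContinuous.exp_logRadius (hf : PosContinuous f) (u : sphere (0 : E) 1) :
    Real.exp (logRadius f u) = (polarDual f u)⁻¹ := by
  rw [logRadius, Real.exp_neg, Real.exp_log (hf.polarDual.pos u)]

theorem PosContinuous.continuous_logRadius (hf : PosContinuous f) : Continuous (logRadius f) :=
  (hf.polarDual.continuous.log fun u => (hf.polarDual.pos u).ne').neg

theorem IsNormal.logRadius_perturb_sub_le (h : IsNormal f u v) (hf : PosContinuous f)
    (hg : Continuous g) (t : ℝ) : logRadius (perturb f g t) u - logRadius f u ≤ t * g v := by
  have hle : polarDual f u * f v ≤ polarDual (perturb f g t) u * (f v * Real.exp (t * g v)) :=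
    h ▸ (hf.perturb hg t).inner_le_wulffGauge_mul u v
  rw [mul_left_comm, mul_comm, mul_le_mul_iff_right₀ (hf.pos v), ← hf.exp_neg_logRadius,
    ← (hf.perturb hg t).exp_neg_logRadius, ← Real.exp_add, Real.exp_le_exp] at hle
  linarith

theorem IsNormal.le_logRadius_perturb_sub {t : ℝ} (h : IsNormal (perturb f g t) u v)
    (hf : PosContinuous f) (hg : Continuous g) :
    t * g v ≤ logRadius (perturb f g t) u - logRadius f u := by
  have := h.logRadius_perturb_sub_le (hf.perturb hg t) hg (-t)
  rw [perturb_perturb, add_neg_cancel, perturb_zero] at this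
  linarith

theorem PosContinuous.abs_logRadius_perturb_sub_le (hf : PosContinuous f) (hg : Continuous g)
    {G : ℝ} (hG : ∀ v, |g v| ≤ G) (u : sphere (0 : E) 1) (s t : ℝ) :
    |logRadius (perturb f g s) u - logRadius (perturb f g t) u| ≤ G * |s - t| := by
  have abs_le (v) : |(s - t) * g v| ≤ G * |s - t| := by
    rw [abs_mul, mul_comm]
    gcongr
    exact hG v
  have hs : perturb f g s = perturb (perturb f g t) g (s - t) := by
    rw [perturb_perturb, add_sub_cancel]
  have hft := hf.perturb hg t
  rw [hs, _root_.abs_le]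
  exact ⟨(neg_le_of_abs_le (abs_le _)).trans
      (((hft.perturb hg _).isNormal_normalMap u).le_logRadius_perturb_sub hft hg),
    ((hft.isNormal_normalMap u).logRadius_perturb_sub_le hft hg _).trans (le_of_abs_le (abs_le _))⟩

theorem PosContinuous.tendsto_normalMap_perturb (hf : PosContinuous f) (hg : Continuous g)
    (hu : ∃! v, IsNormal f u v) :
    Tendsto (fun t => normalMap (perturb f g t) u) (𝓝 0) (𝓝 (normalMap f u)) := by
  obtain ⟨G, hG⟩ := isCompact_univ.exists_bound_of_continuousOn hg.continuousOn
  have hlog : Tendsto (fun t => logRadius (perturb f g t) u) (𝓝 0) (𝓝 (logRadius f u)) := by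
    have hlip : LipschitzWith G.toNNReal fun t => logRadius (perturb f g t) u :=
      LipschitzWith.of_dist_le' fun s t =>
        hf.abs_logRadius_perturb_sub_le hg (fun v => hG v (mem_univ v)) u s t
    simpa only [perturb_zero] using hlip.continuous.tendsto 0
  have hunif : TendstoUniformly (perturb f g) f (𝓝 0) := by
    simpa only [perturb_zero] using Continuous.tendstoUniformly (perturb f g)
      (continuous_uncurry_perturb hf.continuous hg) 0
  refine tendsto_of_isNormal hf.continuous hunif tendsto_const_nhds ?_
    (fun t => (hf.perturb hg t).isNormal_normalMap u) hu (hf.isNormal_normalMap u)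
  simpa only [Function.comp_def, hf.exp_neg_logRadius, (hf.perturb hg _).exp_neg_logRadius] using
    (Real.continuous_exp.tendsto _).comp hlog.neg

theorem PosContinuous.hasDerivAt_logRadius_perturb (hf : PosContinuous f) (hg : Continuous g)
    (hu : ∃! v, IsNormal f u v) :
    HasDerivAt (fun t => logRadius (perturb f g t) u) (g (normalMap f u)) 0 := by
  have hbound (t : ℝ) : ‖logRadius (perturb f g t) u - logRadius f u - t * g (normalMap f u)‖ ≤
      ‖t * (g (normalMap (perturb f g t) u) - g (normalMap f u))‖ := by
    have hle := (hf.isNormal_normalMap u).logRadius_perturb_sub_le hf hg t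
    have hge := ((hf.perturb hg t).isNormal_normalMap u).le_logRadius_perturb_sub hf hg
    rw [mul_sub, Real.norm_of_nonpos (by linarith), Real.norm_of_nonpos (by linarith)]
    linarith
  have hsmall : (fun t => g (normalMap (perturb f g t) u) - g (normalMap f u))
      =o[𝓝 0] fun _ => (1 : ℝ) := by
    rw [Asymptotics.isLittleO_one_iff, tendsto_sub_nhds_zero_iff]
    exact (hg.tendsto _).comp (hf.tendsto_normalMap_perturb hg hu)
  rw [hasDerivAt_iff_isLittleO]
  simp only [perturb_zero, sub_zero, smul_eq_mul]
  refine (Asymptotics.isBigO_of_le _ hbound).trans_isLittleO ?_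
  simpa only [mul_one] using (Asymptotics.isBigO_refl (fun t : ℝ => t) (𝓝 0)).mul_isLittleO hsmall

end LogRadius

/-! ### The Orlicz energy -/

section Potential

variable {ψ : ℝ → ℝ} {r x y : ℝ}

/-- The primitive of `ψ s / s` vanishing at `r`. -/
def orliczPotential (ψ : ℝ → ℝ) (r x : ℝ) : ℝ := ∫ s in r..x, ψ s / s

theorem continuousOn_div_self_Ioi (hψ : ContinuousOn ψ (Ioi 0)) :
    ContinuousOn (fun s => ψ s / s) (Ioi 0) :=
  hψ.div continuousOn_id fun _ hs => ne_of_gt hs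

theorem intervalIntegrable_div_self (hψ : ContinuousOn ψ (Ioi 0)) (hx : 0 < x) (hy : 0 < y) :
    IntervalIntegrable (fun s => ψ s / s) volume x y :=
  ((continuousOn_div_self_Ioi hψ).mono fun _ hs => (lt_min hx hy).trans_le hs.1).intervalIntegrable

theorem hasDerivAt_orliczPotential (hψ : ContinuousOn ψ (Ioi 0)) (hr : 0 < r) (hx : 0 < x) :
    HasDerivAt (orliczPotential ψ r) (ψ x / x) x :=
  intervalIntegral.integral_hasDerivAt_right (intervalIntegrable_div_self hψ hr hx)
    ((continuousOn_div_self_Ioi hψ).stronglyMeasurableAtFilter isOpen_Ioi x hx)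
    ((continuousOn_div_self_Ioi hψ).continuousAt (Ioi_mem_nhds hx))

theorem continuousOn_orliczPotential (hψ : ContinuousOn ψ (Ioi 0)) (hr : 0 < r) :
    ContinuousOn (orliczPotential ψ r) (Ioi 0) :=
  fun _ hx => (hasDerivAt_orliczPotential hψ hr hx).continuousAt.continuousWithinAt

theorem monotoneOn_orliczPotential (hψ : ContinuousOn ψ (Ioi 0)) (hψ0 : ∀ s, 0 < s → 0 < ψ s)
    (hr : 0 < r) : MonotoneOn (orliczPotential ψ r) (Ioi 0) := by
  refine monotoneOn_of_deriv_nonneg (convex_Ioi 0) (continuousOn_orliczPotential hψ hr) ?_ ?_ <;>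
    rw [interior_Ioi] <;> intro s hs
  · exact (hasDerivAt_orliczPotential hψ hr hs).differentiableAt.differentiableWithinAt
  · rw [(hasDerivAt_orliczPotential hψ hr hs).deriv]
    exact (div_pos (hψ0 s hs) hs).le

theorem orliczPotential_nonneg (hψ : ContinuousOn ψ (Ioi 0)) (hψ0 : ∀ s, 0 < s → 0 < ψ s)
    (hr : 0 < r) (hx : r ≤ x) : 0 ≤ orliczPotential ψ r x := by
  simpa only [orliczPotential, intervalIntegral.integral_same] using
    monotoneOn_orliczPotential hψ hψ0 hr hr (hr.trans_le hx) hx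

theorem integrableOn_Ioi_of_orliczPotential_le (hψ : ContinuousOn ψ (Ioi 0))
    (hψ0 : ∀ s, 0 < s → 0 < ψ s) (hr : 0 < r) {C : ℝ}
    (hC : ∀ x, r ≤ x → orliczPotential ψ r x ≤ C) :
    IntegrableOn (fun s => ψ s / s) (Ioi r) := by
  refine integrableOn_Ioi_of_intervalIntegral_norm_bounded (l := atTop) (b := id) C r (fun x => ?_)
    tendsto_id ?_
  · exact ((continuousOn_div_self_Ioi hψ).mono fun s hs => hr.trans_le hs.1).integrableOn_Icc
      |>.mono_set Ioc_subset_Icc_self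
  · filter_upwards [eventually_ge_atTop r] with x hx
    refine (intervalIntegral.integral_congr fun s hs => ?_).trans_le (hC x hx)
    have hs0 : 0 < s := hr.trans_le (uIcc_of_le hx ▸ hs).1
    exact Real.norm_of_nonneg (div_pos (hψ0 s hs0) hs0).le

theorem exists_lt_orliczPotential (hψ : ContinuousOn ψ (Ioi 0)) (hψ0 : ∀ s, 0 < s → 0 < ψ s)
    (hψint : ∫⁻ s in Ioi (1 : ℝ), ENNReal.ofReal (ψ s / s) = ∞) (hr : 0 < r) (C : ℝ) :
    ∃ x ≥ r, C < orliczPotential ψ r x := by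
  by_contra! h
  have hIoi : IntegrableOn (fun s => ψ s / s) (Ioi 1) := by
    have hIcc : IntegrableOn (fun s => ψ s / s) (Icc 1 r) :=
      ((continuousOn_div_self_Ioi hψ).mono fun s hs => one_pos.trans_le hs.1).integrableOn_Icc
    refine (hIcc.union (integrableOn_Ioi_of_orliczPotential_le hψ hψ0 hr h)).mono_set fun s hs => ?_
    exact (le_or_gt s r).imp (fun h => ⟨(mem_Ioi.1 hs).le, h⟩) id
  have h0 : 0 ≤ᵐ[volume.restrict (Ioi 1)] fun s => ψ s / s :=
    (ae_restrict_iff' measurableSet_Ioi).2 <| Eventually.of_forall fun s hs =>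
      (div_pos (hψ0 s (one_pos.trans hs)) (one_pos.trans hs)).le
  exact (hψint ▸ (hasFiniteIntegral_iff_ofReal h0).1 hIoi.2).false

theorem PosContinuous.continuous_orliczPotential {X : Type*} [TopologicalSpace X] {f : X → ℝ}
    (hf : PosContinuous f) (hψ : ContinuousOn ψ (Ioi 0)) (hr : 0 < r) :
    Continuous fun x => orliczPotential ψ r (f x) :=
  (continuousOn_orliczPotential hψ hr).comp_continuous hf.continuous hf.pos

end Potential

section Energy

variable {X : Type*} [MeasurableSpace X] {ψ : ℝ → ℝ} {r : ℝ} {μ : Measure X} {f g : X → ℝ}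

/-- The functional `f ↦ ∫ Ψ(f) dμ`, where `Ψ` is the primitive of `ψ s / s` vanishing at `r`. -/
def orliczEnergy (ψ : ℝ → ℝ) (r : ℝ) (μ : Measure X) (f : X → ℝ) : ℝ :=
  ∫ x, orliczPotential ψ r (f x) ∂μ

variable [TopologicalSpace X] [BorelSpace X] [CompactSpace X] [IsFiniteMeasure μ]

theorem integrable_of_compactSpace (hf : Continuous f) : Integrable f μ :=
  hf.integrable_of_hasCompactSupport (HasCompactSupport.of_compactSpace f)

theorem orliczEnergy_mono (hψ : ContinuousOn ψ (Ioi 0)) (hψ0 : ∀ s, 0 < s → 0 < ψ s)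
    (hr : 0 < r) (hf : PosContinuous f) (hg : PosContinuous g) (hfg : ∀ x, f x ≤ g x) :
    orliczEnergy ψ r μ f ≤ orliczEnergy ψ r μ g :=
  integral_mono (integrable_of_compactSpace (hf.continuous_orliczPotential hψ hr))
    (integrable_of_compactSpace (hg.continuous_orliczPotential hψ hr))
    fun x => monotoneOn_orliczPotential hψ hψ0 hr (hf.pos x) (hg.pos x) (hfg x)

theorem orliczPotential_mul_measureReal_le_orliczEnergy (hψ : ContinuousOn ψ (Ioi 0))
    (hψ0 : ∀ s, 0 < s → 0 < ψ s) (hr : 0 < r) (hf : Continuous f) (hrf : ∀ x, r ≤ f x) {c : ℝ}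
    (hc : r ≤ c) :
    orliczPotential ψ r c * μ.real {x | c ≤ f x} ≤ orliczEnergy ψ r μ f := by
  have hpos : PosContinuous f := ⟨hf, fun x => hr.trans_le (hrf x)⟩
  refine le_trans ?_ (mul_meas_ge_le_integral_of_nonneg
    (Eventually.of_forall fun x => orliczPotential_nonneg hψ hψ0 hr (hrf x))
    (integrable_of_compactSpace (hpos.continuous_orliczPotential hψ hr)) (orliczPotential ψ r c))
  exact mul_le_mul_of_nonneg_left (measureReal_mono fun x hx =>
    monotoneOn_orliczPotential hψ hψ0 hr (hr.trans_le hc) (hpos.pos x) hx)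
    (orliczPotential_nonneg hψ hψ0 hr hc)

theorem hasDerivAt_orliczEnergy_perturb (hψ : ContinuousOn ψ (Ioi 0)) (hr : 0 < r)
    (hf : PosContinuous f) (hg : Continuous g) :
    HasDerivAt (fun t => orliczEnergy ψ r μ (perturb f g t)) (∫ x, ψ (f x) * g x ∂μ) 0 := by
  have hF' : Continuous fun p : ℝ × X => ψ (perturb f g p.1 p.2) * g p.2 :=
    (hψ.comp_continuous (continuous_uncurry_perturb hf.continuous hg)
      fun p => (hf.perturb hg p.1).pos p.2).mul (by fun_prop)
  obtain ⟨C, hC⟩ := (isCompact_Icc.prod isCompact_univ).exists_bound_of_continuousOn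
    (s := Icc (-1 : ℝ) 1 ×ˢ (univ : Set X)) hF'.continuousOn
  have hderiv (x : X) (t : ℝ) : HasDerivAt (fun t => orliczPotential ψ r (perturb f g t x))
      (ψ (perturb f g t x) * g x) t := by
    have hpos := (hf.perturb hg t).pos x
    have hperturb : HasDerivAt (fun t => perturb f g t x) (perturb f g t x * g x) t :=
      ((((hasDerivAt_id t).mul_const (g x)).exp).const_mul (f x)).congr_deriv
        (by simp only [perturb, id]; ring)
    refine ((hasDerivAt_orliczPotential hψ hr hpos).comp t hperturb).congr_deriv ?_
    field_simp
  simpa only [orliczEnergy, perturb_zero] using (hasDerivAt_integral_of_dominated_loc_of_deriv_le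
    (F := fun t x => orliczPotential ψ r (perturb f g t x))
    (F' := fun t x => ψ (perturb f g t x) * g x) (Icc_mem_nhds neg_one_lt_zero zero_lt_one)
    (Eventually.of_forall fun t =>
      ((hf.perturb hg t).continuous_orliczPotential hψ hr).aestronglyMeasurable)
    (integrable_of_compactSpace ((hf.perturb hg 0).continuous_orliczPotential hψ hr))
    (hF'.comp (Continuous.prodMk_right 0)).aestronglyMeasurable
    (Eventually.of_forall fun x t ht => hC (t, x) ⟨ht, mem_univ x⟩) (integrable_const C)
    (Eventually.of_forall fun x t _ => hderiv x t)).2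

end Energy

/-! ### Minimizers of the energy -/

section Cap

theorem integral_le_measureReal_add {X : Type*} [MeasurableSpace X] {μ : Measure X}
    [IsFiniteMeasure μ] {h : X → ℝ} (hm : Measurable h) (hint : Integrable h μ)
    (h1 : ∀ x, h x ≤ 1) {δ : ℝ} (hδ : 0 ≤ δ) :
    ∫ x, h x ∂μ ≤ μ.real {x | δ ≤ h x} + δ * μ.real univ := by
  have hs : MeasurableSet {x | δ ≤ h x} := measurableSet_le measurable_const hm
  have hind : Integrable ({x | δ ≤ h x}.indicator fun _ => (1 : ℝ)) μ :=
    (integrable_const _).indicator hs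
  calc ∫ x, h x ∂μ ≤ ∫ x, ({x | δ ≤ h x}.indicator (fun _ => (1 : ℝ)) x + δ) ∂μ := by
        refine integral_mono hint (hind.add (integrable_const δ)) fun x => ?_
        by_cases hx : x ∈ {x | δ ≤ h x}
        · simp only [indicator_of_mem hx]
          linarith [h1 x]
        · simpa only [indicator_of_notMem hx, zero_add] using (not_le.1 hx).le
    _ = μ.real {x | δ ≤ h x} + δ * μ.real univ := by
        rw [integral_add hind (integrable_const δ), integral_indicator_const _ hs, integral_const,
          smul_eq_mul, smul_eq_mul, mul_one, mul_comm δ]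

variable {E : Type*} [NormedAddCommGroup E] [InnerProductSpace ℝ E] [MeasurableSpace E]
  [BorelSpace E] {μ : Measure (sphere (0 : E) 1)} [IsFiniteMeasure μ]

theorem continuous_integral_max_inner :
    Continuous fun u : sphere (0 : E) 1 => ∫ v, max ⟪(v : E), u⟫_ℝ 0 ∂μ := by
  refine continuous_of_dominated (bound := fun _ => 1)
    (fun u => Continuous.aestronglyMeasurable (by fun_prop))
    (fun u => Eventually.of_forall fun v => ?_) (integrable_const _)
    (Eventually.of_forall fun v => by fun_prop)
  rw [Real.norm_of_nonneg (le_max_right _ _)]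
  exact max_le ((inner_sphere_le (v : E) u).trans (norm_eq_of_mem_sphere v).le) zero_le_one

variable [FiniteDimensional ℝ E] [Nontrivial E]

theorem exists_forall_le_measureReal_cap
    (hμ : ∀ u : sphere (0 : E) 1, 0 < ∫ v, max ⟪(v : E), u⟫_ℝ 0 ∂μ) :
    ∃ δ > 0, ∃ m > 0, ∀ u : sphere (0 : E) 1, m ≤ μ.real {v | δ ≤ ⟪(v : E), u⟫_ℝ} := by
  obtain ⟨I, hI, hIle⟩ := (⟨continuous_integral_max_inner, hμ⟩ :
    PosContinuous fun u : sphere (0 : E) 1 => ∫ v, max ⟪(v : E), u⟫_ℝ 0 ∂μ).exists_pos_le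
  have hden : 0 < μ.real univ + 1 := by positivity
  set δ := I / 2 / (μ.real univ + 1)
  have hδ0 : 0 < δ := by positivity
  refine ⟨δ, hδ0, I / 2, half_pos hI, fun u => ?_⟩
  have hcont : Continuous fun v : sphere (0 : E) 1 => max ⟪(v : E), u⟫_ℝ 0 := by fun_prop
  have hle := (hIle u).trans (integral_le_measureReal_add hcont.measurable
    (integrable_of_compactSpace hcont) (fun v => max_le
      ((inner_sphere_le (v : E) u).trans (norm_eq_of_mem_sphere v).le) zero_le_one) hδ0.le)
  simp only [le_max_iff, hδ0.not_ge, or_false] at hle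
  have hδμ : δ * μ.real univ ≤ I / 2 :=
    (mul_le_mul_of_nonneg_left (by linarith) hδ0.le).trans_eq (div_mul_cancel₀ _ hden.ne')
  linarith

theorem exists_forall_le_of_orliczEnergy_le {ψ : ℝ → ℝ} {r : ℝ} (hψ : ContinuousOn ψ (Ioi 0))
    (hψ0 : ∀ s, 0 < s → 0 < ψ s)
    (hψint : ∫⁻ s in Ioi (1 : ℝ), ENNReal.ofReal (ψ s / s) = ∞) (hr : 0 < r)
    (hμ : ∀ u : sphere (0 : E) 1, 0 < ∫ v, max ⟪(v : E), u⟫_ℝ 0 ∂μ) (C : ℝ) :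
    ∃ R > 0, ∀ f, PosContinuous f → polarDual (polarDual f) = f → (∀ v, r ≤ f v) →
      orliczEnergy ψ r μ f ≤ C → ∀ v, f v ≤ R := by
  obtain ⟨δ, hδ, m, hm, hcap⟩ := exists_forall_le_measureReal_cap hμ
  obtain ⟨x, hrx, hx⟩ := exists_lt_orliczPotential hψ hψ0 hψint hr (C / m)
  refine ⟨x / δ, div_pos (hr.trans_le hrx) hδ, fun f hf hff hrf hC w => ?_⟩
  by_contra! hw
  obtain ⟨u, hu⟩ := hf.exists_mul_inner_le hff w
  have hcap_sub : {v : sphere (0 : E) 1 | δ ≤ ⟪(v : E), u⟫_ℝ} ⊆ {v | x ≤ f v} := fun v hv =>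
    calc x ≤ f w * δ := ((div_lt_iff₀ hδ).1 hw).le
      _ ≤ f w * ⟪(v : E), u⟫_ℝ := mul_le_mul_of_nonneg_left hv (hf.pos w).le
      _ ≤ f v := hu v
  refine lt_irrefl C ?_
  calc C < orliczPotential ψ r x * m := (div_lt_iff₀ hm).1 hx
    _ ≤ orliczPotential ψ r x * μ.real {v | x ≤ f v} := by
        gcongr
        · exact orliczPotential_nonneg hψ hψ0 hr hrx
        · exact (hcap u).trans (measureReal_mono hcap_sub)
    _ ≤ orliczEnergy ψ r μ f :=
        orliczPotential_mul_measureReal_le_orliczEnergy hψ hψ0 hr hf.continuous hrf hrx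
    _ ≤ C := hC

theorem NotConcentratedOnHemisphere.measureReal_univ_ne_zero {n : ℕ} [NeZero n]
    {μ : Measure (USphere n)} [IsFiniteMeasure μ] (hμ : NotConcentratedOnHemisphere μ) :
    μ.real univ ≠ 0 := by
  rw [Ne, measureReal_eq_zero_iff, Measure.measure_univ_eq_zero]
  rintro rfl
  simpa only [integral_zero_measure, lt_irrefl] using hμ (Classical.arbitrary _)

end Cap

section Constraint

variable {E : Type*} [NormedAddCommGroup E] [InnerProductSpace ℝ E]

theorem cone_subset_compl_wulffShape {f : sphere (0 : E) 1 → ℝ} {b c : ℝ} (hb : 0 < b)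
    {v w : sphere (0 : E) 1} (hvw : dist v w ≤ c / 2) (hf0 : 0 ≤ f v) (hfv : f v < b * (c / 2)) :
    {x : E | b ≤ ‖x‖ ∧ c ≤ ⟪‖x‖⁻¹ • x, w⟫_ℝ} ⊆ (wulffShape f)ᶜ := by
  rintro x ⟨hbx, hcx⟩ hx
  have hx0 : 0 < ‖x‖ := hb.trans_le hbx
  have hc : 0 < c / 2 := pos_of_mul_pos_right (hf0.trans_lt hfv) hb.le
  have hsub : ⟪‖x‖⁻¹ • x, (w : E) - v⟫_ℝ ≤ c / 2 := by
    refine (real_inner_le_norm _ _).trans ?_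
    rw [norm_smul, norm_inv, norm_norm, inv_mul_cancel₀ hx0.ne', one_mul, ← dist_eq_norm, dist_comm]
    exact hvw
  have hcv : c / 2 ≤ ⟪‖x‖⁻¹ • x, v⟫_ℝ := by
    rw [inner_sub_right] at hsub
    linarith
  refine hfv.not_ge ?_
  calc b * (c / 2) ≤ ‖x‖ * ⟪‖x‖⁻¹ • x, v⟫_ℝ := by gcongr
    _ = ⟪x, v⟫_ℝ := by rw [real_inner_smul_left, mul_inv_cancel_left₀ hx0.ne']
    _ ≤ f v := hx v

variable [MeasurableSpace E] {ν : Measure E} {M : ℝ≥0∞}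

theorem measure_compl_wulffShape_le_of_tendsto {F : ℕ → sphere (0 : E) 1 → ℝ}
    {f : sphere (0 : E) 1 → ℝ} (hF : ∀ v, Tendsto (fun k => F k v) atTop (𝓝 (f v)))
    (hM : ∀ k, ν (wulffShape (F k))ᶜ ≤ M) : ν (wulffShape f)ᶜ ≤ M := by
  have hmono : Monotone fun k => ⋂ i ≥ k, (wulffShape (F i))ᶜ :=
    fun k l hkl => biInter_mono (fun i hi => hkl.trans hi) fun _ _ => Subset.rfl
  have hsub : (wulffShape f)ᶜ ⊆ ⋃ k, ⋂ i ≥ k, (wulffShape (F i))ᶜ := by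
    intro x hx
    simp only [wulffShape, mem_compl_iff, mem_ofPred_eq, not_forall, not_le] at hx
    obtain ⟨v, hv⟩ := hx
    obtain ⟨k, hk⟩ := eventually_atTop.1 ((hF v).eventually_lt_const hv)
    exact mem_iUnion.2 ⟨k, mem_iInter₂.2 fun i hi h => (hk i hi).not_ge (h v)⟩
  calc ν (wulffShape f)ᶜ ≤ ⨆ k, ν (⋂ i ≥ k, (wulffShape (F i))ᶜ) :=
        (measure_mono hsub).trans_eq hmono.measure_iUnion
    _ ≤ M := iSup_le fun k => (measure_mono (biInter_subset_of_mem le_rfl)).trans (hM k)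

theorem exists_forall_le_of_measure_compl_wulffShape_le [FiniteDimensional ℝ E] (hM : M ≠ ∞)
    (hν : ∀ w : sphere (0 : E) 1, ∃ c > 0, Tendsto
      (fun b => ν {x : E | b ≤ ‖x‖ ∧ c ≤ ⟪‖x‖⁻¹ • x, w⟫_ℝ}) (𝓝[>] 0) (𝓝 ∞)) :
    ∃ r > 0, ∀ f : sphere (0 : E) 1 → ℝ, PosContinuous f → ν (wulffShape f)ᶜ ≤ M →
      ∀ v, r ≤ f v := by
  suffices ∃ r > 0, ∀ v ∈ (univ : Set (sphere (0 : E) 1)), ∀ f : sphere (0 : E) 1 → ℝ,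
      PosContinuous f → ν (wulffShape f)ᶜ ≤ M → r ≤ f v by
    obtain ⟨r, hr, h⟩ := this
    exact ⟨r, hr, fun f hf hfM v => h v (mem_univ v) f hf hfM⟩
  refine isCompact_univ.induction_on
    (p := fun s => ∃ r > 0, ∀ v ∈ s, ∀ f : sphere (0 : E) 1 → ℝ, PosContinuous f →
      ν (wulffShape f)ᶜ ≤ M → r ≤ f v)
    ⟨1, one_pos, fun v hv => hv.elim⟩ (fun s t hst ⟨r, hr, h⟩ => ⟨r, hr, fun v hv => h v (hst hv)⟩)
    (fun s t ⟨r, hr, hs⟩ ⟨r', hr', ht⟩ => ⟨min r r', lt_min hr hr', ?_⟩) fun w _ => ?_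
  · rintro v (hv | hv) f hf hfM
    · exact (min_le_left _ _).trans (hs v hv f hf hfM)
    · exact (min_le_right _ _).trans (ht v hv f hf hfM)
  · obtain ⟨c, hc, hcone⟩ := hν w
    obtain ⟨b, hMb, hb⟩ :=
      ((hcone.eventually_const_lt hM.lt_top).and self_mem_nhdsWithin).exists
    replace hb : 0 < b := hb
    refine ⟨closedBall w (c / 2), nhdsWithin_le_nhds (closedBall_mem_nhds w (half_pos hc)),
      b * (c / 2), by positivity, fun v hv f hf hfM => ?_⟩
    by_contra! hfv
    exact (hMb.trans_le
      (measure_mono (cone_subset_compl_wulffShape hb hv (hf.pos v).le hfv))).not_ge hfM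

end Constraint

section Minimizer

open BoundedContinuousFunction

theorem isCompact_lipschitz_Icc {X : Type*} [PseudoMetricSpace X] [CompactSpace X] (r R : ℝ)
    (K : NNReal) {A : Set (X →ᵇ ℝ)} (hA : IsClosed A)
    (hA' : ∀ f ∈ A, (∀ x, f x ∈ Icc r R) ∧ LipschitzWith K f) : IsCompact A :=
  arzela_ascoli₂ (Icc r R) isCompact_Icc A hA (fun f x hf => (hA' f hf).1 x)
    (LipschitzWith.uniformEquicontinuous (fun f : A => (f : X → ℝ)) K
      fun f => (hA' f f.2).2).equicontinuous

theorem continuousOn_orliczEnergy {X : Type*} [TopologicalSpace X] [MeasurableSpace X]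
    [BorelSpace X] {μ : Measure X} [IsFiniteMeasure μ] {ψ : ℝ → ℝ} {r R : ℝ}
    (hψ : ContinuousOn ψ (Ioi 0)) (hψ0 : ∀ s, 0 < s → 0 < ψ s) (hr : 0 < r) :
    ContinuousOn (fun f : X →ᵇ ℝ => orliczEnergy ψ r μ f) {f | ∀ x, f x ∈ Icc r R} := by
  refine continuousOn_of_dominated (bound := fun _ => orliczPotential ψ r R) (fun f hf => ?_)
    (fun f hf => Eventually.of_forall fun x => ?_) (integrable_const _)
    (Eventually.of_forall fun x => ?_)
  · have hpos : PosContinuous f := ⟨f.continuous, fun x => hr.trans_le (hf x).1⟩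
    exact (hpos.continuous_orliczPotential hψ hr).aestronglyMeasurable
  · rw [Real.norm_of_nonneg (orliczPotential_nonneg hψ hψ0 hr (hf x).1)]
    exact monotoneOn_orliczPotential hψ hψ0 hr (hr.trans_le (hf x).1)
      (hr.trans_le ((hf x).1.trans (hf x).2)) (hf x).2
  · exact (continuousOn_orliczPotential hψ hr).comp (continuous_eval_const x).continuousOn
      fun f hf => hr.trans_le (hf x).1

variable {E : Type*} [NormedAddCommGroup E] [InnerProductSpace ℝ E] [MeasurableSpace E]
  {ν : Measure E} {M : ℝ≥0∞} {r : ℝ}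

theorem isClosed_lipschitz_wulffShape (ν : Measure E) (M : ℝ≥0∞) (r R : ℝ) (K : NNReal) :
    IsClosed {f : sphere (0 : E) 1 →ᵇ ℝ |
      (∀ v, f v ∈ Icc r R) ∧ LipschitzWith K f ∧ ν (wulffShape f)ᶜ ≤ M} := by
  refine IsSeqClosed.isClosed fun F f hF hlim => ?_
  have hpt (v) : Tendsto (fun k => F k v) atTop (𝓝 (f v)) :=
    (continuous_eval_const v).continuousAt.tendsto.comp hlim
  refine ⟨fun v => isClosed_Icc.mem_of_tendsto (hpt v) (Eventually.of_forall fun k => (hF k).1 v),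
    LipschitzWith.of_dist_le_mul fun x y => le_of_tendsto ((hpt x).dist (hpt y))
      (Eventually.of_forall fun k => (hF k).2.1.dist_le_mul x y),
    measure_compl_wulffShape_le_of_tendsto hpt fun k => (hF k).2.2⟩

theorem exists_orliczEnergy_minimizer [FiniteDimensional ℝ E] [Nontrivial E] [BorelSpace E]
    {μ : Measure (sphere (0 : E) 1)} [IsFiniteMeasure μ]
    (hμ : ∀ u : sphere (0 : E) 1, 0 < ∫ v, max ⟪(v : E), u⟫_ℝ 0 ∂μ) {ψ : ℝ → ℝ}
    (hψ : ContinuousOn ψ (Ioi 0)) (hψ0 : ∀ s, 0 < s → 0 < ψ s)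
    (hψint : ∫⁻ s in Ioi (1 : ℝ), ENNReal.ofReal (ψ s / s) = ∞) (hr : 0 < r)
    (hlow : ∀ f, PosContinuous f → ν (wulffShape f)ᶜ ≤ M → ∀ v, r ≤ f v)
    {f₀ : sphere (0 : E) 1 → ℝ} (hf₀ : PosContinuous f₀) (hf₀M : ν (wulffShape f₀)ᶜ ≤ M) :
    ∃ f, PosContinuous f ∧ polarDual (polarDual f) = f ∧ ν (wulffShape f)ᶜ ≤ M ∧
      ∀ g, PosContinuous g → ν (wulffShape g)ᶜ ≤ M →
        orliczEnergy ψ r μ f ≤ orliczEnergy ψ r μ g := by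
  obtain ⟨R, hR, hup⟩ :=
    exists_forall_le_of_orliczEnergy_le hψ hψ0 hψint hr hμ (orliczEnergy ψ r μ f₀)
  set S : Set (sphere (0 : E) 1 →ᵇ ℝ) := {f | (∀ v, f v ∈ Icc r R) ∧
    LipschitzWith R.toNNReal f ∧ ν (wulffShape f)ᶜ ≤ M}
  have henergy (g) (hg : PosContinuous g) :
      orliczEnergy ψ r μ (polarDual (polarDual g)) ≤ orliczEnergy ψ r μ g :=
    orliczEnergy_mono hψ hψ0 hr hg.polarDual.polarDual hg hg.polarDual_polarDual_le
  have hmem (g) (hg : PosContinuous g) (hgM : ν (wulffShape g)ᶜ ≤ M)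
      (hgC : orliczEnergy ψ r μ g ≤ orliczEnergy ψ r μ f₀) :
      mkOfCompact ⟨_, hg.polarDual.polarDual.continuous⟩ ∈ S := by
    have hgM' := hg.wulffShape_polarDual_polarDual.symm ▸ hgM
    have hgr := hlow _ hg.polarDual.polarDual hgM'
    have hgR := hup _ hg.polarDual.polarDual hg.polarDual.polarDual_polarDual_polarDual hgr
      ((henergy g hg).trans hgC)
    exact ⟨fun v => ⟨hgr v, hgR v⟩, hg.lipschitzWith_polarDual_polarDual hR hgR, hgM'⟩
  obtain ⟨f, hf, hmin⟩ := (isCompact_lipschitz_Icc r R R.toNNReal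
    (isClosed_lipschitz_wulffShape ν M r R _) fun f hf => ⟨hf.1, hf.2.1⟩).exists_isMinOn
    ⟨_, hmem f₀ hf₀ hf₀M le_rfl⟩ ((continuousOn_orliczEnergy (μ := μ) hψ hψ0 hr).mono
      fun f hf => hf.1)
  have hfpos : PosContinuous f := ⟨f.continuous, fun v => hr.trans_le (hf.1 v).1⟩
  have hle (g) (hg : PosContinuous g) (hgM : ν (wulffShape g)ᶜ ≤ M)
      (hgC : orliczEnergy ψ r μ g ≤ orliczEnergy ψ r μ f₀) :
      orliczEnergy ψ r μ (polarDual (polarDual f)) ≤ orliczEnergy ψ r μ g :=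
    (henergy f hfpos).trans ((hmin (hmem g hg hgM hgC)).trans (henergy g hg))
  refine ⟨polarDual (polarDual f), hfpos.polarDual.polarDual,
    hfpos.polarDual.polarDual_polarDual_polarDual,
    hfpos.wulffShape_polarDual_polarDual.symm ▸ hf.2.2, fun g hg hgM => ?_⟩
  rcases le_total (orliczEnergy ψ r μ g) (orliczEnergy ψ r μ f₀) with hgC | hgC
  · exact hle g hg hgM hgC
  · exact (hle f₀ hf₀ hf₀M le_rfl).trans hgC

end Minimizer

/-! ### Variation of the weighted volume -/

section Polar

theorem lintegral_eq_lintegral_toSphere {E : Type*} [NormedAddCommGroup E] [NormedSpace ℝ E]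
    [FiniteDimensional ℝ E] [Nontrivial E] [MeasurableSpace E] [BorelSpace E] (ν : Measure E)
    [ν.IsAddHaarMeasure] {G : E → ℝ≥0∞} (hG : Measurable G) :
    ∫⁻ x, G x ∂ν = ∫⁻ u : sphere (0 : E) 1, (∫⁻ r in Ioi (0 : ℝ),
      ENNReal.ofReal (r ^ (Module.finrank ℝ E - 1)) * G (r • (u : E))) ∂ν.toSphere := by
  have hG' : Measurable fun p : sphere (0 : E) 1 × Ioi (0 : ℝ) => G ((p.2 : ℝ) • (p.1 : E)) := by
    fun_prop
  calc ∫⁻ x, G x ∂ν = ∫⁻ x : ({(0 : E)}ᶜ : Set E), G x ∂(ν.comap Subtype.val) := by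
        rw [lintegral_subtype_comap (measurableSet_singleton _).compl, restrict_compl_singleton]
    _ = ∫⁻ x : ({(0 : E)}ᶜ : Set E), (fun p : sphere (0 : E) 1 × Ioi (0 : ℝ) =>
          G ((p.2 : ℝ) • (p.1 : E))) (homeomorphUnitSphereProd E x) ∂(ν.comap Subtype.val) :=
        lintegral_congr fun x => congrArg G
          (congrArg Subtype.val ((homeomorphUnitSphereProd E).symm_apply_apply x)).symm
    _ = ∫⁻ u : sphere (0 : E) 1, ∫⁻ r : Ioi (0 : ℝ), G ((r : ℝ) • (u : E))
          ∂(Measure.volumeIoiPow (Module.finrank ℝ E - 1)) ∂ν.toSphere := by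
        rw [ν.measurePreserving_homeomorphUnitSphereProd.lintegral_comp hG',
          lintegral_prod _ hG'.aemeasurable]
    _ = _ := lintegral_congr fun u => by
        rw [Measure.volumeIoiPow, lintegral_withDensity_eq_lintegral_mul _ (by fun_prop)
          (by fun_prop)]
        exact lintegral_subtype_comap measurableSet_Ioi
          fun r : ℝ => ENNReal.ofReal (r ^ (Module.finrank ℝ E - 1)) * G (r • (u : E))

variable {n : ℕ} {φ : RSpace n → ℝ}

instance isFiniteMeasure_sphereMeasure : IsFiniteMeasure (sphereMeasure n) :=
  inferInstanceAs (IsFiniteMeasure (volume : Measure (RSpace n)).toSphere)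

theorem withDensity_eq_phiVolume (φ : RSpace n → ℝ) (A : Set (RSpace n)) :
    volume.withDensity (fun x => ENNReal.ofReal (φ x)) A = phiVolume φ A :=
  withDensity_apply' _ A

theorem measurable_PhiBar (hφ : Measurable φ) : Measurable (PhiBar φ) := by
  have hind : Measurable fun q : (ℝ × USphere n) × ℝ => (Ioi q.1.1).indicator
      (fun r => ENNReal.ofReal (φ (r • (q.1.2 : RSpace n)) * r ^ (n - 1))) q.2 :=
    Measurable.ite (p := fun q : (ℝ × USphere n) × ℝ => q.1.1 < q.2)
      (measurableSet_lt (by fun_prop) (by fun_prop)) (by fun_prop) measurable_const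
  have hlint := hind.lintegral_prod_right' (ν := volume)
  simp only [lintegral_indicator measurableSet_Ioi] at hlint
  exact hlint

theorem phiVolume_eq_lintegral_PhiBar [NeZero n] (hφ : Measurable φ) {A : Set (RSpace n)}
    (hA : MeasurableSet A) {ρ : USphere n → ℝ} (hρ : ∀ u, 0 ≤ ρ u)
    (hAρ : ∀ (u : USphere n) (r : ℝ), 0 < r → (r • (u : RSpace n) ∈ A ↔ ρ u < r)) :
    phiVolume φ A = ∫⁻ u, PhiBar φ (ρ u, u) ∂(sphereMeasure n) := by
  rw [phiVolume, ← lintegral_indicator hA, lintegral_eq_lintegral_toSphere _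
    (hφ.ennreal_ofReal.indicator hA), finrank_euclideanSpace_fin]
  refine lintegral_congr fun u => ?_
  rw [PhiBar, ← inter_eq_self_of_subset_left (Ioi_subset_Ioi (hρ u)),
    ← setLIntegral_indicator measurableSet_Ioi]
  refine setLIntegral_congr_fun measurableSet_Ioi fun r hr => ?_
  by_cases hrρ : ρ u < r
  · rw [indicator_of_mem ((hAρ u r hr).2 hrρ), indicator_of_mem (mem_Ioi.2 hrρ), mul_comm (φ _),
      ENNReal.ofReal_mul (pow_nonneg (le_of_lt hr) _)]
  · rw [indicator_of_notMem (mt (hAρ u r hr).1 hrρ), indicator_of_notMem (mt mem_Ioi.1 hrρ),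
      mul_zero]

theorem phiVolume_compl_closedBall_one [NeZero n] (hφ : Measurable φ) :
    phiVolume φ (closedBall 0 1)ᶜ = ∫⁻ u, PhiBar φ (1, u) ∂(sphereMeasure n) :=
  phiVolume_eq_lintegral_PhiBar hφ isClosed_closedBall.measurableSet.compl
    (fun _ => zero_le_one) fun u r hr => by
      rw [mem_compl_iff, mem_closedBall_zero_iff, norm_smul, norm_eq_of_mem_sphere, mul_one,
        Real.norm_of_nonneg hr.le, not_le]

end Polar

section Variation

variable {n : ℕ} {φ : RSpace n → ℝ} {f g : USphere n → ℝ}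

/-- Weights which are continuous and positive away from the origin and integrable away from any
neighbourhood of it. -/
structure IsTailWeight (φ : RSpace n → ℝ) : Prop where
  continuousOn : ContinuousOn φ {x | x ≠ 0}
  pos : ∀ x, x ≠ 0 → 0 < φ x
  tail_ne_top : phiVolume φ (closedBall 0 1)ᶜ ≠ ∞

theorem isTailWeight_of_continuousOn_PhiBar [NeZero n] (hφ : ContinuousOn φ {x | x ≠ 0})
    (hφ0 : ∀ x, x ≠ 0 → 0 < φ x) (hΦ : ∀ u, PhiBar φ (1, u) ≠ ∞)
    (hΦcont : ContinuousOn (PhiBar φ) (Ioi (0 : ℝ) ×ˢ univ)) : IsTailWeight φ := by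
  refine ⟨hφ, hφ0, ?_⟩
  have hcont : Continuous fun u => PhiBar φ (1, u) :=
    hΦcont.comp_continuous (by fun_prop) fun u => ⟨mem_Ioi.2 one_pos, mem_univ u⟩
  obtain ⟨u, -, hu⟩ := isCompact_univ.exists_isMaxOn univ_nonempty hcont.continuousOn
  rw [phiVolume_compl_closedBall_one (measurable_of_continuousOn_compl_singleton 0 hφ)]
  refine ((lintegral_mono fun v => hu (mem_univ v)).trans_lt ?_).ne
  rw [lintegral_const]
  exact ENNReal.mul_lt_top (hΦ u).lt_top (measure_lt_top _ _)

/-- The derivative of `-Φ̄` in the variable `log t`. With `t` the radial function of a convex body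
this is the density in the dual curvature measure of the body. -/
def polarDensity (φ : RSpace n → ℝ) (t : ℝ) (u : USphere n) : ℝ :=
  φ (t • (u : RSpace n)) * t ^ n

namespace IsTailWeight

theorem measurable (hφ : IsTailWeight φ) : Measurable φ :=
  measurable_of_continuousOn_compl_singleton 0 hφ.continuousOn

theorem phiVolume_compl_closedBall_ne_top (hφ : IsTailWeight φ) {r : ℝ} (hr : 0 < r) :
    phiVolume φ (closedBall 0 r)ᶜ ≠ ∞ := by
  have hann : IntegrableOn φ (closedBall 0 1 \ ball 0 r) :=
    (hφ.continuousOn.mono fun x hx h0 => hx.2 (h0 ▸ mem_ball_self hr)).integrableOn_compact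
      ((isCompact_closedBall 0 1).diff isOpen_ball)
  have hsub : (closedBall 0 r)ᶜ ⊆ closedBall 0 1 \ ball 0 r ∪ (closedBall (0 : RSpace n) 1)ᶜ :=
    fun x hx => (em (x ∈ closedBall 0 1)).imp_left
      fun h => ⟨h, fun h' => hx (ball_subset_closedBall h')⟩
  refine ((lintegral_mono_set hsub).trans_lt ((lintegral_union_le _ _ _).trans_lt
    (ENNReal.add_lt_top.2 ⟨?_, hφ.tail_ne_top.lt_top⟩))).ne
  exact (lintegral_ofReal_le_lintegral_enorm φ).trans_lt hann.2

theorem phiVolume_compl_wulffShape_ne_top [NeZero n] (hφ : IsTailWeight φ)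
    (hf : PosContinuous f) : phiVolume φ (wulffShape f)ᶜ ≠ ∞ :=
  let ⟨_, hr, hrf⟩ := hf.exists_pos_le
  ((lintegral_mono_set (compl_subset_compl.2 (closedBall_subset_wulffShape hrf))).trans_lt
    (hφ.phiVolume_compl_closedBall_ne_top hr).lt_top).ne

theorem phiVolume_compl_wulffShape [NeZero n] (hφ : IsTailWeight φ) (hf : PosContinuous f) :
    phiVolume φ (wulffShape f)ᶜ =
      ∫⁻ u, PhiBar φ (Real.exp (logRadius f u), u) ∂(sphereMeasure n) :=
  phiVolume_eq_lintegral_PhiBar hφ.measurable (isClosed_wulffShape f).measurableSet.compl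
    (fun u => (Real.exp_pos _).le) fun u r hr => by
      rw [mem_compl_iff, hf.smul_mem_wulffShape_iff hr.le, not_le, hf.exp_logRadius]

theorem ae_PhiBar_one_ne_top [NeZero n] (hφ : IsTailWeight φ) :
    ∀ᵐ u ∂(sphereMeasure n), PhiBar φ (1, u) ≠ ∞ := by
  refine (ae_lt_top (f := fun u => PhiBar φ (1, u))
    ((measurable_PhiBar hφ.measurable).comp measurable_prodMk_left) ?_).mono fun u hu => hu.ne
  rw [← phiVolume_compl_closedBall_one hφ.measurable]
  exact hφ.tail_ne_top

theorem continuousOn_ray (hφ : IsTailWeight φ) (u : USphere n) (k : ℕ) :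
    ContinuousOn (fun r : ℝ => φ (r • (u : RSpace n)) * r ^ k) (Ioi 0) :=
  (hφ.continuousOn.comp (by fun_prop) fun _ hr => smul_ne_zero (ne_of_gt hr)
    (ne_zero_of_mem_unit_sphere u)).mul (by fun_prop)

theorem ray_nonneg (hφ : IsTailWeight φ) (u : USphere n) (k : ℕ) {r : ℝ} (hr : 0 < r) :
    0 ≤ φ (r • (u : RSpace n)) * r ^ k :=
  (mul_pos (hφ.pos _ (smul_ne_zero hr.ne' (ne_zero_of_mem_unit_sphere u))) (pow_pos hr k)).le

theorem integrableOn_ray (hφ : IsTailWeight φ) {u : USphere n} (hu : PhiBar φ (1, u) ≠ ∞) {t : ℝ}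
    (ht : 0 < t) : IntegrableOn (fun r : ℝ => φ (r • (u : RSpace n)) * r ^ (n - 1)) (Ioi t) := by
  have hone : IntegrableOn (fun r : ℝ => φ (r • (u : RSpace n)) * r ^ (n - 1)) (Ioi 1) := by
    refine ⟨((hφ.continuousOn_ray u _).mono (Ioi_subset_Ioi zero_le_one)).aestronglyMeasurable
      measurableSet_Ioi, (hasFiniteIntegral_iff_ofReal ?_).2 hu.lt_top⟩
    exact (ae_restrict_iff' measurableSet_Ioi).2
      (Eventually.of_forall fun r hr => hφ.ray_nonneg u _ (one_pos.trans hr))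
  refine ((((hφ.continuousOn_ray u _).mono fun r hr => ht.trans_le hr.1).integrableOn_Icc
    (b := 1)).union hone).mono_set fun r hr => ?_
  exact (le_or_gt r 1).imp (fun h => ⟨(mem_Ioi.1 hr).le, h⟩) id

theorem toReal_PhiBar (hφ : IsTailWeight φ) (u : USphere n) {t : ℝ} (ht : 0 < t) :
    (PhiBar φ (t, u)).toReal = ∫ r in Ioi t, φ (r • (u : RSpace n)) * r ^ (n - 1) :=
  (integral_eq_lintegral_of_nonneg_ae ((ae_restrict_iff' measurableSet_Ioi).2
      (Eventually.of_forall fun _ hr => hφ.ray_nonneg u _ (ht.trans hr)))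
    (((hφ.continuousOn_ray u _).mono (Ioi_subset_Ioi ht.le)).aestronglyMeasurable
      measurableSet_Ioi)).symm

theorem hasDerivAt_toReal_PhiBar (hφ : IsTailWeight φ) {u : USphere n} (hu : PhiBar φ (1, u) ≠ ∞)
    {t : ℝ} (ht : 0 < t) : HasDerivAt (fun s => (PhiBar φ (s, u)).toReal)
      (-(φ (t • (u : RSpace n)) * t ^ (n - 1))) t := by
  have hint := intervalIntegral.integral_hasDerivAt_right
    (IntervalIntegrable.refl (μ := volume) (a := t))
    ((hφ.continuousOn_ray u (n - 1)).stronglyMeasurableAtFilter isOpen_Ioi t ht)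
    ((hφ.continuousOn_ray u _).continuousAt (Ioi_mem_nhds ht))
  refine (hint.const_sub (PhiBar φ (t, u)).toReal).congr_of_eventuallyEq ?_
  filter_upwards [Ioi_mem_nhds ht] with s hs
  rw [hφ.toReal_PhiBar u hs, hφ.toReal_PhiBar u ht, ← intervalIntegral.integral_Ioi_sub_Ioi'
    (hφ.integrableOn_ray hu ht) (hφ.integrableOn_ray hu hs), sub_sub_cancel]

theorem hasDerivAt_toReal_PhiBar_exp [NeZero n] (hφ : IsTailWeight φ) {u : USphere n}
    (hu : PhiBar φ (1, u) ≠ ∞) (s : ℝ) : HasDerivAt (fun s => (PhiBar φ (Real.exp s, u)).toReal)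
      (-polarDensity φ (Real.exp s) u) s := by
  refine ((hφ.hasDerivAt_toReal_PhiBar hu (Real.exp_pos s)).comp s
    (Real.hasDerivAt_exp s)).congr_deriv ?_
  rw [polarDensity, neg_mul, mul_assoc, pow_sub_one_mul (NeZero.ne n)]

theorem continuous_uncurry_polarDensity_exp (hφ : IsTailWeight φ) :
    Continuous fun p : ℝ × USphere n => polarDensity φ (Real.exp p.1) p.2 :=
  (hφ.continuousOn.comp_continuous (f := fun p : ℝ × USphere n => Real.exp p.1 • (p.2 : RSpace n))
    (by fun_prop) fun p => smul_ne_zero (Real.exp_ne_zero _)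
      (ne_zero_of_mem_unit_sphere p.2)).mul (by fun_prop)

theorem exists_lipschitzOnWith_toReal_PhiBar_exp [NeZero n] (hφ : IsTailWeight φ) (S : ℝ) :
    ∃ C : NNReal, ∀ u : USphere n, PhiBar φ (1, u) ≠ ∞ →
      LipschitzOnWith C (fun s => (PhiBar φ (Real.exp s, u)).toReal) (Icc (-S) S) := by
  obtain ⟨C, hC⟩ := (isCompact_Icc.prod isCompact_univ).exists_bound_of_continuousOn
    (s := Icc (-S) S ×ˢ univ) hφ.continuous_uncurry_polarDensity_exp.continuousOn
  refine ⟨C.toNNReal, fun u hu => (convex_Icc _ _).lipschitzOnWith_of_nnnorm_hasDerivWithin_le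
    (fun s _ => (hφ.hasDerivAt_toReal_PhiBar_exp hu s).hasDerivWithinAt) fun s hs => ?_⟩
  rw [nnnorm_neg]
  exact NNReal.le_toNNReal_of_coe_le (hC (s, u) ⟨hs, mem_univ u⟩)

variable [NeZero n]

theorem exists_lipschitzOnWith_toReal_PhiBar_perturb (hφ : IsTailWeight φ) (hf : PosContinuous f)
    (hg : Continuous g) : ∃ C : NNReal, ∀ u : USphere n, PhiBar φ (1, u) ≠ ∞ → LipschitzOnWith C
      (fun t => (PhiBar φ (Real.exp (logRadius (perturb f g t) u), u)).toReal) (Icc (-1) 1) := by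
  obtain ⟨G, hG⟩ := isCompact_univ.exists_bound_of_continuousOn hg.continuousOn
  replace hG (v) : |g v| ≤ G := hG v (mem_univ v)
  obtain ⟨L, hL⟩ := isCompact_univ.exists_bound_of_continuousOn hf.continuous_logRadius.continuousOn
  obtain ⟨C, hC⟩ := hφ.exists_lipschitzOnWith_toReal_PhiBar_exp (L + G)
  have hlip (u : USphere n) : LipschitzWith G.toNNReal fun t => logRadius (perturb f g t) u :=
    LipschitzWith.of_dist_le' fun s t => hf.abs_logRadius_perturb_sub_le hg hG u s t
  refine ⟨C * G.toNNReal, fun u hu => (hC u hu).comp ((hlip u).lipschitzOnWith) fun t ht => ?_⟩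
  have hG0 : 0 ≤ G := (abs_nonneg _).trans (hG u)
  have hdist := hf.abs_logRadius_perturb_sub_le hg hG u t 0
  rw [perturb_zero, sub_zero] at hdist
  rw [mem_Icc, ← abs_le]
  calc |logRadius (perturb f g t) u|
      ≤ |logRadius f u| + |logRadius (perturb f g t) u - logRadius f u| := by
        simpa only [add_sub_cancel] using abs_add_le (logRadius f u) (_ - logRadius f u)
    _ ≤ L + G := add_le_add (hL u (mem_univ u))
        (hdist.trans (mul_le_of_le_one_right hG0 (abs_le.2 ht)))

theorem measurable_PhiBar_exp_logRadius (hφ : IsTailWeight φ) (hf : PosContinuous f) :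
    Measurable fun u => PhiBar φ (Real.exp (logRadius f u), u) :=
  (measurable_PhiBar hφ.measurable).comp
    ((Real.continuous_exp.comp hf.continuous_logRadius).prodMk continuous_id).measurable

theorem toReal_phiVolume_compl_wulffShape (hφ : IsTailWeight φ) (hf : PosContinuous f) :
    (phiVolume φ (wulffShape f)ᶜ).toReal =
      ∫ u, (PhiBar φ (Real.exp (logRadius f u), u)).toReal ∂(sphereMeasure n) := by
  rw [hφ.phiVolume_compl_wulffShape hf]
  refine (integral_toReal (hφ.measurable_PhiBar_exp_logRadius hf).aemeasurable
    (ae_lt_top (hφ.measurable_PhiBar_exp_logRadius hf) ?_)).symm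
  rw [← hφ.phiVolume_compl_wulffShape hf]
  exact hφ.phiVolume_compl_wulffShape_ne_top hf

theorem hasDerivAt_toReal_phiVolume_compl_wulffShape (hφ : IsTailWeight φ) (hf : PosContinuous f)
    (hg : Continuous g) :
    HasDerivAt (fun t => (phiVolume φ (wulffShape (perturb f g t))ᶜ).toReal)
      (∫ u, -(polarDensity φ (polarDual f u)⁻¹ u * g (normalMap f u)) ∂(sphereMeasure n)) 0 := by
  simp only [hφ.toReal_phiVolume_compl_wulffShape (hf.perturb hg _), ← hf.exp_logRadius]
  obtain ⟨C, hC⟩ := hφ.exists_lipschitzOnWith_toReal_PhiBar_perturb hf hg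
  have hdens : Continuous fun u => polarDensity φ (Real.exp (logRadius f u)) u :=
    hφ.continuous_uncurry_polarDensity_exp.comp (hf.continuous_logRadius.prodMk continuous_id)
  refine (hasDerivAt_integral_of_dominated_loc_of_lip
    (Icc_mem_nhds neg_one_lt_zero zero_lt_one) (bound := fun _ => C)
    (Eventually.of_forall fun t => (hφ.measurable_PhiBar_exp_logRadius
      (hf.perturb hg t)).ennreal_toReal.aestronglyMeasurable) ?_ ?_ ?_ (integrable_const _) ?_).2
  · refine integrable_toReal_of_lintegral_ne_top
      (hφ.measurable_PhiBar_exp_logRadius (hf.perturb hg 0)).aemeasurable ?_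
    rw [← hφ.phiVolume_compl_wulffShape (hf.perturb hg 0)]
    exact hφ.phiVolume_compl_wulffShape_ne_top (hf.perturb hg 0)
  · exact (hdens.aemeasurable.mul (hg.measurable.comp_aemeasurable
      (hf.aemeasurable_normalMap volume))).neg.aestronglyMeasurable
  · filter_upwards [hφ.ae_PhiBar_one_ne_top] with u hu
    simpa only [Real.nnabs_coe] using hC u hu
  · filter_upwards [hφ.ae_PhiBar_one_ne_top, hf.ae_existsUnique_isNormal volume] with u hu hnormal
    have hlog := hf.hasDerivAt_logRadius_perturb hg hnormal
    have hPhi := hφ.hasDerivAt_toReal_PhiBar_exp hu (logRadius (perturb f g 0) u)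
    simpa only [Function.comp_def, perturb_zero, neg_mul] using hPhi.comp (0 : ℝ) hlog

end IsTailWeight
end Variation

/-! ### The Gauss image of a Wulff shape -/

section WulffBody

variable {E : Type*} [NormedAddCommGroup E] [InnerProductSpace ℝ E] {f : sphere (0 : E) 1 → ℝ}

theorem convex_wulffShape (f : sphere (0 : E) 1 → ℝ) : Convex ℝ (wulffShape f) := by
  simp only [wulffShape, ofPred_forall]
  exact convex_iInter fun v => convex_halfSpace_le ((innerₗ E).flip (v : E)).isLinear (f v)

theorem inner_lt_of_mem_interior_wulffShape {x : E} (hx : x ∈ interior (wulffShape f))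
    (v : sphere (0 : E) 1) : ⟪x, v⟫_ℝ < f v := by
  have hlim : Tendsto (fun t : ℝ => x + t • (v : E)) (𝓝[>] 0) (𝓝 x) :=
    tendsto_nhdsWithin_of_tendsto_nhds (Continuous.tendsto' (by fun_prop) _ _ (by simp))
  obtain ⟨t, hxt, ht⟩ := ((hlim.eventually (mem_interior_iff_mem_nhds.1 hx)).and
    self_mem_nhdsWithin).exists
  have hle := hxt v
  rw [inner_add_left, real_inner_smul_left, inner_sphere_self, mul_one] at hle
  exact (lt_add_of_pos_right _ ht).trans_le hle

namespace PosContinuous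

variable [FiniteDimensional ℝ E] [Nontrivial E]

theorem zero_mem_interior_wulffShape (hf : PosContinuous f) : (0 : E) ∈ interior (wulffShape f) :=
  let ⟨_, hr, hrf⟩ := hf.exists_pos_le
  mem_interior_iff_mem_nhds.2
    (mem_of_superset (closedBall_mem_nhds 0 hr) (closedBall_subset_wulffShape hrf))

/-- The Wulff shape of a positive continuous function, as a convex body. -/
def wulffBody (hf : PosContinuous f) : ConvexBody E where
  carrier := wulffShape f
  convex' := convex_wulffShape f
  isCompact' := let ⟨_, _, hR⟩ := hf.exists_le
    isCompact_of_isClosed_isBounded (isClosed_wulffShape f)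
      (isBounded_closedBall.subset (wulffShape_subset_closedBall hR))
  nonempty' := ⟨0, interior_subset hf.zero_mem_interior_wulffShape⟩

theorem wulffGauge_eq_one (hf : PosContinuous f) {x : E} {v : sphere (0 : E) 1}
    (hx : x ∈ wulffShape f) (hxv : ⟪x, v⟫_ℝ = f v) : wulffGauge f x = 1 :=
  le_antisymm (hf.mem_wulffShape_iff.1 hx) <| by
    simpa only [hxv, le_mul_iff_one_le_left (hf.pos v)] using hf.inner_le_wulffGauge_mul x v

theorem isNormal_of_inner_eq (hf : PosContinuous f) {x : E} {u v : sphere (0 : E) 1}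
    (hx : x ∈ wulffShape f) (hxv : ⟪x, v⟫_ℝ = f v) (hu : (u : E) = ‖x‖⁻¹ • x) :
    IsNormal f u v := by
  rw [IsNormal, polarDual, hu, wulffGauge_smul f (inv_nonneg.2 (norm_nonneg x)),
    hf.wulffGauge_eq_one hx hxv, real_inner_smul_left, hxv, mul_one]

end PosContinuous
end WulffBody

section GaussImage

variable {n : ℕ} [NeZero n] {f : USphere n → ℝ}

namespace PosContinuous

theorem radialFn_wulffShape (hf : PosContinuous f) (u : USphere n) :
    radialFn (wulffShape f) u = (polarDual f u)⁻¹ := by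
  have hIoc : {s : ℝ | 0 < s ∧ s • (u : RSpace n) ∈ wulffShape f} = Ioc 0 (polarDual f u)⁻¹ :=
    ext fun s => and_congr_right fun hs => hf.smul_mem_wulffShape_iff hs.le u
  rw [radialFn, hIoc, csSup_Ioc (inv_pos.2 (hf.polarDual.pos u))]

theorem supportFn_wulffShape (hf : PosContinuous f) (hff : polarDual (polarDual f) = f)
    (v : USphere n) : supportFn (wulffShape f) v = f v := by
  obtain ⟨u, hu⟩ := hf.polarDual.exists_inner_eq_wulffGauge_mul (v : RSpace n)
  have hu0 := hf.polarDual.pos u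
  refine IsGreatest.csSup_eq ⟨⟨(polarDual f u)⁻¹ • (u : RSpace n),
    (hf.smul_mem_wulffShape_iff (inv_pos.2 hu0).le u).2 le_rfl, ?_⟩, ?_⟩
  · change inner ℝ (v : RSpace n) u = polarDual (polarDual f) v * polarDual f u at hu
    simp only [inner_smul_right, hu, hff]
    field_simp
  · rintro _ ⟨x, hx, rfl⟩
    simp only [real_inner_comm]
    exact hx v

theorem mem_supportingHyperplane_iff (hf : PosContinuous f) (hff : polarDual (polarDual f) = f)
    (u v : USphere n) :
    radialFn (wulffShape f) u • (u : RSpace n) ∈ supportingHyperplane (wulffShape f) v ↔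
      IsNormal f u v := by
  rw [supportingHyperplane, mem_ofPred_eq, hf.radialFn_wulffShape, hf.supportFn_wulffShape hff,
    real_inner_smul_left, IsNormal, inv_mul_eq_iff_eq_mul₀ (hf.polarDual.pos u).ne']

theorem radialGaussMap_wulffShape (hf : PosContinuous f) (hff : polarDual (polarDual f) = f)
    {u : USphere n} (hu : ∃! v, IsNormal f u v) :
    radialGaussMap (wulffShape f) u = normalMap f u := by
  have himage (v) : v ∈ radialGaussImage (wulffShape f) {u} ↔ IsNormal f u v := by
    simp only [radialGaussImage, mem_singleton_iff, exists_eq_left, mem_ofPred_eq,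
      hf.mem_supportingHyperplane_iff hff]
  have hex : ∃! v, v ∈ radialGaussImage (wulffShape f) {u} := (existsUnique_congr himage).2 hu
  rw [radialGaussMap, dif_pos hex]
  exact hu.unique ((himage _).1 hex.choose_spec.1) (hf.isNormal_normalMap u)

theorem mem_reverseRadialGaussImage_iff (hf : PosContinuous f)
    (hff : polarDual (polarDual f) = f) {A : Set (USphere n)} {u : USphere n} :
    u ∈ reverseRadialGaussImage (wulffShape f) A ↔ ∃ v ∈ A, IsNormal f u v := by
  refine exists_congr fun v => and_congr_right fun _ => ⟨?_, fun hv => ?_⟩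
  · rintro ⟨x, ⟨hxK, hxH⟩, hux⟩
    exact hf.isNormal_of_inner_eq ((isClosed_wulffShape f).frontier_subset hxK)
      (hxH.trans (hf.supportFn_wulffShape hff v)) hux
  · have hmem := (hf.mem_supportingHyperplane_iff hff u v).2 hv
    have hρ : 0 < radialFn (wulffShape f) u := by
      rw [hf.radialFn_wulffShape]
      exact inv_pos.2 (hf.polarDual.pos u)
    refine ⟨radialFn (wulffShape f) u • (u : RSpace n), ⟨⟨subset_closure ?_, fun hint => ?_⟩, hmem⟩,
      ?_⟩
    · rw [hf.smul_mem_wulffShape_iff hρ.le, hf.radialFn_wulffShape]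
    · exact (inner_lt_of_mem_interior_wulffShape hint v).ne
        (hmem.trans (hf.supportFn_wulffShape hff v))
    · rw [norm_smul, norm_eq_of_mem_sphere, mul_one, Real.norm_of_nonneg hρ.le,
        inv_smul_smul₀ hρ.ne']

theorem reverseRadialGaussImage_ae_eq (hf : PosContinuous f)
    (hff : polarDual (polarDual f) = f) (A : Set (USphere n)) :
    reverseRadialGaussImage (wulffShape f) A =ᵐ[sphereMeasure n] normalMap f ⁻¹' A := by
  filter_upwards [hf.ae_existsUnique_isNormal volume] with u hu
  refine propext ((hf.mem_reverseRadialGaussImage_iff hff).trans ⟨?_, fun h =>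
    ⟨_, h, hf.isNormal_normalMap u⟩⟩)
  rintro ⟨v, hvA, hv⟩
  exact mem_of_eq_of_mem (hu.unique (hf.isNormal_normalMap u) hv) hvA

end PosContinuous

/-- The measure on the sphere assigning to `A` the integral over `α*_K(A)` of `φ(ρ_K(u) u) ρ_K(u)ⁿ`,
where `K` is the Wulff shape of `f`. -/
def dualCurvature (φ : RSpace n → ℝ) (f : USphere n → ℝ) : Measure (USphere n) :=
  ((sphereMeasure n).withDensity
    fun u => ENNReal.ofReal (polarDensity φ (polarDual f u)⁻¹ u)).map (normalMap f)

variable {φ : RSpace n → ℝ}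

theorem PosContinuous.aemeasurable_normalMap_withDensity (hf : PosContinuous f)
    (w : USphere n → ℝ≥0∞) : AEMeasurable (normalMap f) ((sphereMeasure n).withDensity w) :=
  (hf.aemeasurable_normalMap volume).mono_ac (withDensity_absolutelyContinuous _ _)

namespace IsTailWeight

theorem posContinuous_polarDensity (hφ : IsTailWeight φ) (hf : PosContinuous f) :
    PosContinuous fun u => polarDensity φ (polarDual f u)⁻¹ u where
  continuous := by
    simp only [← hf.exp_logRadius]
    exact hφ.continuous_uncurry_polarDensity_exp.comp
      (hf.continuous_logRadius.prodMk continuous_id)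
  pos u := mul_pos (hφ.pos _ (smul_ne_zero (inv_pos.2 (hf.polarDual.pos u)).ne'
    (ne_zero_of_mem_unit_sphere u))) (pow_pos (inv_pos.2 (hf.polarDual.pos u)) n)

theorem isFiniteMeasure_dualCurvature (hφ : IsTailWeight φ) (hf : PosContinuous f) :
    IsFiniteMeasure (dualCurvature φ f) := by
  have := isFiniteMeasure_withDensity_ofReal (integrable_of_compactSpace (μ := sphereMeasure n)
    (hφ.posContinuous_polarDensity hf).continuous).2
  rw [dualCurvature]
  infer_instance

theorem setIntegral_dualCurvature (hφ : IsTailWeight φ) (hf : PosContinuous f) {g : USphere n → ℝ}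
    (hg : Continuous g) {A : Set (USphere n)} (hA : MeasurableSet A) :
    ∫ v in A, g v ∂(dualCurvature φ f) = ∫ u in normalMap f ⁻¹' A,
      polarDensity φ (polarDual f u)⁻¹ u * g (normalMap f u) ∂(sphereMeasure n) := by
  have hw := hφ.posContinuous_polarDensity hf
  rw [dualCurvature, setIntegral_map hA hg.aestronglyMeasurable
    (hf.aemeasurable_normalMap_withDensity _),
    setIntegral_withDensity_eq_setIntegral_toReal_smul₀' _
      hw.continuous.measurable.ennreal_ofReal.aemeasurable
      (Eventually.of_forall fun _ => ENNReal.ofReal_lt_top)]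
  simp only [ENNReal.toReal_ofReal (hw.pos _).le, smul_eq_mul]

theorem integral_dualCurvature (hφ : IsTailWeight φ) (hf : PosContinuous f) {g : USphere n → ℝ}
    (hg : Continuous g) : ∫ v, g v ∂(dualCurvature φ f) =
      ∫ u, polarDensity φ (polarDual f u)⁻¹ u * g (normalMap f u) ∂(sphereMeasure n) := by
  simpa only [preimage_univ, Measure.restrict_univ] using
    hφ.setIntegral_dualCurvature hf hg MeasurableSet.univ

theorem neZero_dualCurvature (hφ : IsTailWeight φ) (hf : PosContinuous f) :
    NeZero (dualCurvature φ f) := by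
  have hw := hφ.posContinuous_polarDensity hf
  have hne : NeZero (sphereMeasure n) :=
    inferInstanceAs (NeZero (volume : Measure (RSpace n)).toSphere)
  rw [neZero_iff, dualCurvature, Ne,
    Measure.map_eq_zero_iff (hf.aemeasurable_normalMap_withDensity _),
    withDensity_eq_zero_iff hw.continuous.measurable.ennreal_ofReal.aemeasurable]
  intro hzero
  obtain ⟨u, hu⟩ := hzero.exists
  exact (ENNReal.ofReal_pos.2 (hw.pos u)).ne' hu

theorem dualOrliczCurvature_wulffShape (hφ : IsTailWeight φ) (hf : PosContinuous f)
    (hff : polarDual (polarDual f) = f) {ψ : ℝ → ℝ} (hψf : PosContinuous fun v => ψ (f v))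
    {A : Set (USphere n)} (hA : MeasurableSet A) :
    dualOrliczCurvature φ ψ (wulffShape f) A =
      1 / (n : ℝ) * ∫ v in A, (ψ (f v))⁻¹ ∂(dualCurvature φ f) := by
  rw [dualOrliczCurvature, setIntegral_congr_set (hf.reverseRadialGaussImage_ae_eq hff A),
    hφ.setIntegral_dualCurvature hf hψf.inv.continuous hA]
  congr 1
  refine integral_congr_ae (ae_restrict_of_ae ?_)
  filter_upwards [hf.ae_existsUnique_isNormal volume] with u hu
  rw [hf.radialFn_wulffShape, hf.radialGaussMap_wulffShape hff hu, hf.supportFn_wulffShape hff,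
    polarDensity, div_eq_mul_inv]

end IsTailWeight
end GaussImage

/-! ### The Euler–Lagrange equation -/

section EulerLagrange

theorem nonneg_of_hasDerivAt_of_constrained_min {J V : ℝ → ℝ} {j v a : ℝ} (hJ : HasDerivAt J j a)
    (hV : HasDerivAt V v a) (hv : v < 0) (hmin : ∀ t, V t ≤ V a → J a ≤ J t) : 0 ≤ j := by
  have hJslope := hasDerivWithinAt_iff_tendsto_slope' self_notMem_Ioi |>.1 hJ.hasDerivWithinAt
  have hVslope := hasDerivWithinAt_iff_tendsto_slope' self_notMem_Ioi |>.1 hV.hasDerivWithinAt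
  refine ge_of_tendsto hJslope ?_
  filter_upwards [hVslope.eventually_lt_const hv, self_mem_nhdsWithin] with t htV ht
  have ht : 0 < t - a := sub_pos.2 ht
  rw [slope_def_field, div_lt_iff₀ ht, zero_mul, sub_neg] at htV
  rw [slope_def_field]
  exact div_nonneg (sub_nonneg.2 (hmin t htV.le)) ht.le

theorem exists_eq_smul_of_forall_integral_nonneg {X : Type*} [TopologicalSpace X] [CompactSpace X]
    [HasOuterApproxClosed X] [MeasurableSpace X] [BorelSpace X] {ν₁ ν₂ : Measure X}
    [IsFiniteMeasure ν₁] [IsFiniteMeasure ν₂] [NeZero ν₁]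
    (h : ∀ g : X → ℝ, Continuous g → 0 < ∫ x, g x ∂ν₁ → 0 ≤ ∫ x, g x ∂ν₂) :
    ∃ c : NNReal, ν₂ = c • ν₁ := by
  have hm : 0 < ν₁.real univ := measureReal_univ_pos
  obtain ⟨c, hc⟩ : ∃ c : NNReal, (c : ℝ) = ν₂.real univ / ν₁.real univ :=
    ⟨⟨_, by positivity⟩, rfl⟩
  have hle (g : X → ℝ) (hg : Continuous g) : c * ∫ x, g x ∂ν₁ ≤ ∫ x, g x ∂ν₂ := by
    have hlim : Tendsto (fun δ => ∫ x, g x ∂ν₂ - c * ∫ x, g x ∂ν₁ + δ * ν₂.real univ) (𝓝[>] 0)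
        (𝓝 (∫ x, g x ∂ν₂ - c * ∫ x, g x ∂ν₁)) :=
      tendsto_nhdsWithin_of_tendsto_nhds (Continuous.tendsto' (by fun_prop) _ _ (by simp))
    refine sub_nonneg.1 (ge_of_tendsto hlim ?_)
    filter_upwards [self_mem_nhdsWithin] with δ hδ
    have hint (ν : Measure X) [IsFiniteMeasure ν] (a : ℝ) :
        ∫ x, (g x + a) ∂ν = ∫ x, g x ∂ν + a * ν.real univ := by
      rw [integral_add (integrable_of_compactSpace hg) (integrable_const a), integral_const,
        smul_eq_mul, mul_comm]
    have hnonneg := h (fun x => g x + (δ - (∫ x, g x ∂ν₁) / ν₁.real univ)) (by fun_prop) (by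
      rw [hint, sub_mul, div_mul_cancel₀ _ hm.ne', add_sub_cancel]
      exact mul_pos hδ hm)
    rw [hint] at hnonneg
    rw [hc]
    linear_combination hnonneg
  refine ⟨c, ext_of_forall_integral_eq_of_IsFiniteMeasure fun g => ?_⟩
  rw [integral_smul_nnreal_measure, NNReal.smul_def, smul_eq_mul]
  refine le_antisymm ?_ (hle g g.continuous)
  simpa only [integral_neg, mul_neg, neg_le_neg_iff] using hle (fun x => -g x) g.continuous.neg

variable {n : ℕ} [NeZero n] {φ : RSpace n → ℝ} {ψ : ℝ → ℝ} {f : USphere n → ℝ}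
  {μ : Measure (USphere n)} [IsFiniteMeasure μ]

theorem IsTailWeight.integral_mul_nonneg_of_minimizer (hφ : IsTailWeight φ)
    (hψ : ContinuousOn ψ (Ioi 0)) {r : ℝ} (hr : 0 < r) (hf : PosContinuous f)
    (hmin : ∀ g, PosContinuous g → phiVolume φ (wulffShape g)ᶜ ≤ phiVolume φ (wulffShape f)ᶜ →
      orliczEnergy ψ r μ f ≤ orliczEnergy ψ r μ g) {g : USphere n → ℝ} (hg : Continuous g)
    (hpos : 0 < ∫ v, g v ∂(dualCurvature φ f)) : 0 ≤ ∫ v, ψ (f v) * g v ∂μ := by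
  have hV := hφ.hasDerivAt_toReal_phiVolume_compl_wulffShape hf hg
  have hJ := hasDerivAt_orliczEnergy_perturb (μ := μ) hψ hr hf hg
  refine nonneg_of_hasDerivAt_of_constrained_min hJ hV ?_ fun t ht => ?_
  · rw [integral_neg, neg_lt_zero]
    exact hpos.trans_eq (hφ.integral_dualCurvature hf hg)
  · rw [perturb_zero, ENNReal.toReal_le_toReal (hφ.phiVolume_compl_wulffShape_ne_top
      (hf.perturb hg t)) (hφ.phiVolume_compl_wulffShape_ne_top hf)] at ht
    rw [perturb_zero]
    exact hmin _ (hf.perturb hg t) ht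

theorem IsTailWeight.exists_withDensity_eq_smul_dualCurvature (hφ : IsTailWeight φ)
    (hψ : ContinuousOn ψ (Ioi 0)) (hψ0 : ∀ s, 0 < s → 0 < ψ s) {r : ℝ} (hr : 0 < r)
    (hf : PosContinuous f)
    (hmin : ∀ g, PosContinuous g → phiVolume φ (wulffShape g)ᶜ ≤ phiVolume φ (wulffShape f)ᶜ →
      orliczEnergy ψ r μ f ≤ orliczEnergy ψ r μ g) :
    ∃ c : NNReal, μ.withDensity (fun v => ENNReal.ofReal (ψ (f v))) = c • dualCurvature φ f := by
  have := hφ.isFiniteMeasure_dualCurvature hf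
  have := hφ.neZero_dualCurvature hf
  have hψf : Continuous fun v => ψ (f v) := hψ.comp_continuous hf.continuous hf.pos
  have := isFiniteMeasure_withDensity_ofReal (integrable_of_compactSpace (μ := μ) hψf).2
  refine exists_eq_smul_of_forall_integral_nonneg fun g hg hpos => ?_
  rw [integral_withDensity_eq_integral_toReal_smul hψf.measurable.ennreal_ofReal
    (Eventually.of_forall fun _ => ENNReal.ofReal_lt_top)]
  simp only [ENNReal.toReal_ofReal (hψ0 _ (hf.pos _)).le, smul_eq_mul]
  exact hφ.integral_mul_nonneg_of_minimizer hψ hr hf hmin hg hpos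

theorem measureReal_eq_setIntegral_inv_withDensity {X : Type*} [MeasurableSpace X] {μ : Measure X}
    {q : X → ℝ} (hq : Measurable q) (hq0 : ∀ x, 0 < q x) {A : Set X}
    (hA : MeasurableSet A) :
    μ.real A = ∫ x in A, (q x)⁻¹ ∂(μ.withDensity fun x => ENNReal.ofReal (q x)) := by
  rw [setIntegral_withDensity_eq_setIntegral_toReal_smul hq.ennreal_ofReal
    (Eventually.of_forall fun _ => ENNReal.ofReal_lt_top) _ hA]
  simp only [ENNReal.toReal_ofReal (hq0 _).le, smul_eq_mul, mul_inv_cancel₀ (hq0 _).ne',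
    setIntegral_const, mul_one]

theorem IsTailWeight.exists_measureReal_eq_mul_dualOrliczCurvature (hφ : IsTailWeight φ)
    (hψ : ContinuousOn ψ (Ioi 0)) (hψ0 : ∀ s, 0 < s → 0 < ψ s) {r : ℝ} (hr : 0 < r)
    (hf : PosContinuous f) (hff : polarDual (polarDual f) = f)
    (hmin : ∀ g, PosContinuous g → phiVolume φ (wulffShape g)ᶜ ≤ phiVolume φ (wulffShape f)ᶜ →
      orliczEnergy ψ r μ f ≤ orliczEnergy ψ r μ g) :
    ∃ c : ℝ, ∀ A, MeasurableSet A → μ.real A = c * dualOrliczCurvature φ ψ (wulffShape f) A := by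
  have hψf : PosContinuous fun v => ψ (f v) :=
    ⟨hψ.comp_continuous hf.continuous hf.pos, fun v => hψ0 _ (hf.pos v)⟩
  obtain ⟨c, hc⟩ := hφ.exists_withDensity_eq_smul_dualCurvature (μ := μ) hψ hψ0 hr hf hmin
  refine ⟨c * n, fun A hA => ?_⟩
  rw [measureReal_eq_setIntegral_inv_withDensity hψf.continuous.measurable hψf.pos hA, hc,
    Measure.restrict_smul, integral_smul_nnreal_measure, NNReal.smul_def, smul_eq_mul,
    hφ.dualOrliczCurvature_wulffShape hf hff hψf hA, mul_assoc, one_div,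
    mul_inv_cancel_left₀ (NeZero.ne (n : ℝ))]

end EulerLagrange

end DualOrlicz

end

theorem mainTheorem12_general {n : ℕ} [NeZero n]
    {μ : Measure (DualOrlicz.USphere n)} [IsFiniteMeasure μ]
    (hμ : DualOrlicz.NotConcentratedOnHemisphere μ)
    {φ : DualOrlicz.RSpace n → ℝ} (hφ : DualOrlicz.IsTailWeight φ)
    (hcone : ∀ v : DualOrlicz.USphere n, ∃ c > 0,
      Tendsto (fun b : ℝ => DualOrlicz.phiVolume φ (DualOrlicz.truncatedCone v b c))
        (𝓝[>] 0) (𝓝 ∞))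
    {ψ : ℝ → ℝ} (hψ : ContinuousOn ψ (Ioi 0)) (hψ0 : ∀ s, 0 < s → 0 < ψ s)
    (hψint : ∫⁻ s in Ioi (1 : ℝ), ENNReal.ofReal (ψ s / s) = ∞) :
    ∃ K : ConvexBody (DualOrlicz.RSpace n),
      (0 : DualOrlicz.RSpace n) ∈ interior (K : Set (DualOrlicz.RSpace n)) ∧
      DualOrlicz.dualOrliczCurvature φ ψ (K : Set (DualOrlicz.RSpace n)) univ ≠ 0 ∧
      ∀ A : Set (DualOrlicz.USphere n), MeasurableSet A →
        μ.real A / μ.real univ =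
          DualOrlicz.dualOrliczCurvature φ ψ (K : Set (DualOrlicz.RSpace n)) A /
            DualOrlicz.dualOrliczCurvature φ ψ (K : Set (DualOrlicz.RSpace n)) univ := by
  have hone : DualOrlicz.PosContinuous fun _ : DualOrlicz.USphere n => (1 : ℝ) :=
    ⟨continuous_const, fun _ => one_pos⟩
  have hM := hφ.phiVolume_compl_wulffShape_ne_top hone
  simp only [← DualOrlicz.withDensity_eq_phiVolume] at hcone hM
  obtain ⟨r, hr, hlow⟩ := DualOrlicz.exists_forall_le_of_measure_compl_wulffShape_le hM hcone
  obtain ⟨f, hf, hff, hfM, hmin⟩ :=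
    DualOrlicz.exists_orliczEnergy_minimizer hμ hψ hψ0 hψint hr hlow hone le_rfl
  simp only [DualOrlicz.withDensity_eq_phiVolume] at hfM hmin
  obtain ⟨c, hc⟩ := hφ.exists_measureReal_eq_mul_dualOrliczCurvature hψ hψ0 hr hf hff
    fun g hg hgf => hmin g hg (hgf.trans hfM)
  have hμ0 : c * DualOrlicz.dualOrliczCurvature φ ψ (DualOrlicz.wulffShape f) univ ≠ 0 := by
    rw [← hc univ MeasurableSet.univ]
    exact hμ.measureReal_univ_ne_zero
  refine ⟨hf.wulffBody, hf.zero_mem_interior_wulffShape, right_ne_zero_of_mul hμ0, fun A hA => ?_⟩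
  rw [hc A hA, hc univ MeasurableSet.univ, mul_div_mul_left _ _ (left_ne_zero_of_mul hμ0)]
  rfl

theorem mainTheorem12 (n : ℕ) (hn : 1 ≤ n)
    (μ : Measure (DualOrlicz.USphere n)) [IsFiniteMeasure μ] (hμ : μ ≠ 0)
    (hμconc : DualOrlicz.NotConcentratedOnHemisphere μ)
    (φ : DualOrlicz.RSpace n → ℝ)
    (hφcont : ContinuousOn φ {x | x ≠ 0}) (hφpos : ∀ x, x ≠ 0 → 0 < φ x)
    (hΦfin : ∀ t : ℝ, 0 < t → ∀ u : DualOrlicz.USphere n, DualOrlicz.PhiBar φ (t, u) ≠ ∞)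
    (hΦcont : ContinuousOn (DualOrlicz.PhiBar φ) (Ioi (0 : ℝ) ×ˢ univ))
    (hcone : ∀ (v : DualOrlicz.USphere n) (c : ℝ), 0 < c → c < 1 →
      Tendsto (fun b : ℝ => DualOrlicz.phiVolume φ (DualOrlicz.truncatedCone v b c))
        (𝓝[>] 0) (𝓝 ∞))
    (ψ : ℝ → ℝ) (hψcont : ContinuousOn ψ (Ioi 0)) (hψpos : ∀ s, 0 < s → 0 < ψ s)
    (hψint : ∫⁻ s in Ioi (1 : ℝ), ENNReal.ofReal (ψ s / s) = ∞) :
    ∃ K : ConvexBody (DualOrlicz.RSpace n),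
      (0 : DualOrlicz.RSpace n) ∈ interior (K : Set (DualOrlicz.RSpace n)) ∧
      DualOrlicz.dualOrliczCurvature φ ψ (K : Set (DualOrlicz.RSpace n)) univ ≠ 0 ∧
      ∀ A : Set (DualOrlicz.USphere n), MeasurableSet A →
        μ.real A / μ.real univ =
          DualOrlicz.dualOrliczCurvature φ ψ (K : Set (DualOrlicz.RSpace n)) A /
            DualOrlicz.dualOrliczCurvature φ ψ (K : Set (DualOrlicz.RSpace n)) univ := by
  have : NeZero n := ⟨Nat.one_le_iff_ne_zero.1 hn⟩
  exact mainTheorem12_general hμconc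
    (DualOrlicz.isTailWeight_of_continuousOn_PhiBar hφcont hφpos (hΦfin 1 one_pos) hΦcont)
    (fun v => ⟨1 / 2, one_half_pos, hcone v _ one_half_pos one_half_lt_one⟩) hψcont hψpos hψint
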